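/- **Setting.** Let $\mathbb X,\mathbb Y$ be finite-dimensional real normed spaces (dual norms $\|\cdot\|_*$), $\mathcal X\subseteq\mathbb X$ and $\mathcal Y\subseteq\mathbb Y$ nonempty, closed and convex, $\mathcal Y$ bounded with diameter $D_{\mathcal Y}$. Let $r$ and $g$ be convex, and $M_r$- resp. $M_g$-Lipschitz on $\mathcal X$ resp. $\mathcal Y$. A distance generating function (DGF) on a set $U$ is a function $\omega$ with values in $\mathbb R\cup\{+\infty\}$ that is finite, continuous and $1$-strongly convex on $U$ and essentially smooth ($C^1$ on $\operatorname{int}\operatorname{dom}\omega\neq\emptyset$, with $\|\nabla\omega\|_*\to\infty$ at the boundary of $\operatorname{dom}\omega$); $D_\omega(a,b)=\omega(a)-\omega(b)-\langle\nabla\omega(b),a-b\rangle$ and $U^o=U\cap\operatorname{int}\operatorname{dom}\omega$. Let $\omega_{\mathcal X}$, $\omega_{\mathcal Y}$ be DGFs on $\mathcal X$, $\mathcal Y$, with $\mathcal X\subseteq\operatorname{int}\operatorname{dom}\omega_{\mathcal X}$ and $\nabla\omega_{\mathcal X}$ $\beta_{\mathcal X}$-Lipschitz on $\mathcal X$ ($\beta_{\mathcal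 X}\ge1$), and let $\Omega=\sup_{y\in\mathcal Y}|\omega_{\mathcal Y}(y)|>0$. Assume that $r$ and $g$ have Bregman proximal projections: for $(U,\omega,\varphi)=(\mathcal X,\omega_{\mathcal X},r)$ and $(\mathcal Y,\omega_{\mathcal Y},g)$, all $b\in U^o$, all linear $\xi$ and all $\lambda>0$, the problem $\min_{a\in U}\varphi(a)+\langle\xi,a\rangle+\lambda^{-1}D_\omega(a,b)$ has a unique solution, and it lies in $U^o$. Let $0<\mu\le L'_{xx}$, $L_{xy}>0$, $L_{yy}\ge0$, and let $\Psi$ be a real function, continuous on $\mathcal X\times\mathcal Y$, such that for all $x,x'\in\mathcal X$ and $y,y'\in\mathcal Y$: $\Psi(\cdot,y)$ is differentiable at $x$ and $0\le\Psi(x',y)-\Psi(x,y)-\langle\nabla_x\Psi(x,y),x'-x\rangle\le\frac{L'_{xx}}2\|x'-x\|^2$; $\|\nabla_x\Psi(x,y)-\nabla_x\Psi(x,y')\|_*\le L_{xy}\|y-y'\|$; $\Psi(x,\cdot)$ is concave on $\mathcal Y$ and differentiable at $y$; $\|\nabla_y\Psi(x,y)-\nabla_y\Psi(x',y)\|_*\le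 L_{xy}\|x-x'\|$; $\|\nabla_y\Psi(x,y)-\nabla_y\Psi(x,y')\|_*\le L_{yy}\|y-y'\|$. A call to the primal (dual) oracle at $(x,y)\in\mathcal X\times\mathcal Y$ returns $\nabla_x\Psi(x,y)$ ($\nabla_y\Psi(x,y)$). For $\rho\ge0$ consider $\min_{x\in\mathcal X}\max_{y\in\mathcal Y}\ \mu\omega_{\mathcal X}(x)+r(x)+\Psi(x,y)-g(y)-\rho\omega_{\mathcal Y}(y)$. Put $\psi^{\mathrm P}(x,y)=\Psi(x,y)+r(x)+\mu\omega_{\mathcal X}(x)$, $\pi(y)=\inf_{x\in\mathcal X}\psi^{\mathrm P}(x,y)$, $p_\rho(x)=\sup_{y\in\mathcal Y}\{\Psi(x,y)-g(y)-\rho\omega_{\mathcal Y}(y)\}+r(x)+\mu\omega_{\mathcal X}(x)$, $d_\rho(y)=\pi(y)-g(y)-\rho\omega_{\mathcal Y}(y)$, $p_\rho^*=\inf_{\mathcal X}p_\rho$, $d_\rho^*=\sup_{\mathcal Y}d_\rho$, and $\Delta(x,y)=p_0(x)-d_0(y)$. **Parameters.** Given $\varepsilon>0$ let $\rho=\varepsilon/(4\Omega)$,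 $L_\pi=L_{yy}+L_{xy}^2/\mu$, $L'_\rho=L'_{xx}+L_{xy}^2/\rho$. Fix, independently of $\varepsilon$, points $\hat y\in\mathcal Y$ with $d_1^*-d_1(\hat y)\le\frac12$ and $\hat x\in\mathcal X$ with $\psi^{\mathrm P}(\hat x,\hat y)-\pi(\hat y)\le\frac12$, and put $$B=L_{xy}D_{\mathcal Y}+\sup_{y\in\mathcal Y}\|\nabla_x\Psi(\hat x,y)\|_*+\tfrac{L'_{xx}}{\sqrt\mu}\Big(1+\tfrac{L_{xy}}{\sqrt\mu}+2\sqrt\Omega\Big)+2L'_\rho\sqrt{\rho\Omega/\mu},$$ $$B'=\|\nabla\omega_{\mathcal X}(\hat x)\|_*+\tfrac{\beta_{\mathcal X}}{\sqrt\mu}\Big(1+\tfrac{L_{xy}}{\sqrt\mu}+2\sqrt\Omega(1+\sqrt\rho)\Big),\qquad \kappa=\min\Big\{\frac{\varepsilon}{8(B+M_r+B')^2},\frac1{L'_\rho+\beta_{\mathcal X}}\Big\},$$ $$\varepsilon_3=\min\Big\{\frac{\varepsilon\mu^2\rho}{64L_{xy}^2}\kappa,\frac\varepsilon4\Big\},\qquad\varepsilon_4=\frac{\varepsilon\mu}{64}\kappa,\qquad\delta_2=\frac{\varepsilon_3\,\mu\,\rho^{3/2}}{(14\sqrt2)^2L_{xy}^2L_\pi^{1/2}(1+\sqrt{L_\pi/\rho})^2}.$$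 **Method.** The (inexact) accelerated proximal gradient method APG$(U,h,\varphi,\omega,\nu,L)$ for $\min_U h+\varphi+\nu\omega$, from $u^0$, sets $\tau=\sqrt{L/\nu}$, $\eta=\sqrt{L\nu}$, $\alpha=\tau/(1+\tau)$, $u^{-1}=\hat u^0=u^0$, and for $t\ge1$: $\tilde u^t=u^{t-1}+\alpha(u^{t-1}-u^{t-2})$, $\hat u^t=(\tilde u^t+\tau\hat u^{t-1})/(1+\tau)$, $u^t=\operatorname{argmin}_{u\in U}\varphi(u)+\nu\omega(u)+\langle\hat\nabla h(\hat u^t),u\rangle+\eta D_\omega(u,u^{t-1})$, where $\hat\nabla h$ is a (possibly inexact) gradient of $h$; after $k$ steps it outputs $\big(\sum_{t\le k}\alpha^{-t}\big)^{-1}\sum_{t\le k}\alpha^{-t}u^t$. Fix $x^0\in\mathcal X$ and $y^0\in\mathcal Y^o$. The *primal solver* at $y$ with $n$ steps is APG$(\mathcal X,\Psi(\cdot,y),r,\omega_{\mathcal X},\mu,L'_{xx})$ from $x^0$ with exact gradients (one primal call per step). The *dual-smoothing method* with iteration numbers $(k,n,m)$ runs $k$ steps of APG$(\mathcal Y,-\pi,g,\omega_{\mathcal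 Y},\rho,L_\pi)$ from $y^0$, with inexact gradient $-\nabla_y\Psi(x,\hat u^t)$ where $x$ is the output of $n$ steps of the primal solver at $\hat u^t$ (one dual call per step); let $y$ be its output; it then runs $m$ steps of the primal solver at $y$, with output $x$, and returns $(x,y)$. **Theorem.** (a) For every $\varepsilon>0$, if $x\in\mathcal X$ and $y\in\mathcal Y$ satisfy $d_\rho^*-d_\rho(y)\le\varepsilon_3$ and $\psi^{\mathrm P}(x,y)-\pi(y)\le\varepsilon_4$, then $p_\rho(x)-p_\rho^*\le\varepsilon/4$ and $\Delta(x,y)\le\varepsilon$. (b) There are a universal constant $C>0$ and, for every problem as above and every choice of $x^0,y^0,\hat x,\hat y$, a threshold $\varepsilon_0>0$ such that for every $\varepsilon>0$ there are iteration numbers $(k,n,m)$ with the following properties. For all $k'\ge k$, $n'\ge n$, $m'\ge m$, the primal solver with $n'$ steps is $\delta_2$-accurate at every $y\in\mathcal Y$ (its output $x$ lies in $\mathcal X$ and $\psi^{\mathrm P}(x,y)-\pi(y)\le\delta_2$), and the method with iteration numbers $(k',n',m')$ returns a pair $(x,y)\in\mathcal X\times\mathcal Y$ that satisfies the hypotheses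 of (a), hence $$p_\rho(x)-p_\rho^*\le\varepsilon/4,\qquad\Delta(x,y)\le\varepsilon .$$ If moreover $\varepsilon\le\varepsilon_0$, then the method with iteration numbers $(k,n,m)$ makes at most $$C\sqrt{\Omega}\;\sqrt{L'_{xx}/\mu}\,\big(\sqrt{L_{yy}}+L_{xy}/\sqrt\mu\big)\,\varepsilon^{-1/2}\log^2(1/\varepsilon)$$ primal oracle calls and at most $$C\sqrt{\Omega}\;\big(\sqrt{L_{yy}}+L_{xy}/\sqrt\mu\big)\,\varepsilon^{-1/2}\log(1/\varepsilon)$$ dual oracle calls. -/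

import Mathlib

open Set Filter Topology

universe u v w

/-- The Bregman divergence `D_ω(a, b) = ω(a) - ω(b) - ⟨∇ω(b), a - b⟩`. -/
noncomputable def bregman {V : Type*} [NormedAddCommGroup V] [NormedSpace ℝ V]
    (omega : V → ℝ) (a b : V) : ℝ :=
  omega a - omega b - fderiv ℝ omega b (a - b)

/-- `omega`, an extended-real function that is real-valued on its domain `dom` and `+∞` off it, is a
distance generating function on `U`: it is essentially smooth, and it is (finite,) continuous and
`1`-strongly convex on `U`. -/
structure IsDGF {V : Type*} [NormedAddCommGroup V] [NormedSpace ℝ V]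
    (U dom : Set V) (omega : V → ℝ) : Prop where
  subset_dom : U ⊆ dom
  interior_nonempty : (interior dom).Nonempty
  contDiffOn : ContDiffOn ℝ 1 omega (interior dom)
  blowup : ∀ a ∈ frontier dom,
    Tendsto (fun b => ‖fderiv ℝ omega b‖) (𝓝[interior dom] a) atTop
  continuousOn : ContinuousOn omega U
  strongConvexOn : StrongConvexOn U 1 omega

/-- `phi` has a Bregman proximal projection on `U`: for all `ξ`, `lam > 0` and `a ∈ U ∩ int dom ω`,
the problem `min_{b ∈ U} phi(b) + ⟨ξ, b⟩ + lam⁻¹ D_ω(b, a)` has a unique solution, and it lies in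
`U ∩ int dom ω`. -/
def HasBPP {V : Type*} [NormedAddCommGroup V] [NormedSpace ℝ V]
    (U dom : Set V) (omega phi : V → ℝ) : Prop :=
  ∀ a ∈ U ∩ interior dom, ∀ (xi : V →L[ℝ] ℝ) (lam : ℝ), 0 < lam →
    ∃ p ∈ U ∩ interior dom, ∀ b ∈ U, b ≠ p →
      phi p + xi p + lam⁻¹ * bregman omega p a < phi b + xi b + lam⁻¹ * bregman omega b a

/-- The minimizer of `f` over `U` (some minimizer if there are several, `0` if there is none). -/
noncomputable def argminOn {V : Type*} [Zero V] (U : Set V) (f : V → ℝ) : V :=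
  open Classical in
  if h : ∃ p, p ∈ U ∧ ∀ b ∈ U, f p ≤ f b then h.choose else 0

/-! ### Programs with a primal and a dual first-order oracle -/

/-- A (deterministic, adaptive) program that may query a primal oracle and a dual oracle at points
`(x, y)` and finally returns a value. -/
inductive OracleProg (E : Type u) (F : Type v) [NormedAddCommGroup E] [NormedSpace ℝ E]
    [NormedAddCommGroup F] [NormedSpace ℝ F] (A : Type w) : Type (max u v w)
  | ret (a : A) : OracleProg E F A
  | primal (x : E) (y : F) (k : (E →L[ℝ] ℝ) → OracleProg E F A) : OracleProg E F A
  | dual (x : E) (y : F) (k : (F →L[ℝ] ℝ) → OracleProg E F A) : OracleProg E F A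

namespace OracleProg

variable {E : Type u} {F : Type v} [NormedAddCommGroup E] [NormedSpace ℝ E]
  [NormedAddCommGroup F] [NormedSpace ℝ F]

/-- Sequential composition. -/
def bind {A : Type*} {B : Type*} : OracleProg E F A → (A → OracleProg E F B) → OracleProg E F B
  | ret a, f => f a
  | primal x y k, f => primal x y (fun s => (k s).bind f)
  | dual x y k, f => dual x y (fun s => (k s).bind f)

/-- The value returned when the oracles answer by `OX` and `OY`. -/
def result {A : Type*} (OX : E → F → (E →L[ℝ] ℝ)) (OY : E → F → (F →L[ℝ] ℝ)) :
    OracleProg E F A → A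
  | ret a => a
  | primal x y k => (k (OX x y)).result OX OY
  | dual x y k => (k (OY x y)).result OX OY

/-- The number of calls to the primal oracle. -/
def primalCalls {A : Type*} (OX : E → F → (E →L[ℝ] ℝ)) (OY : E → F → (F →L[ℝ] ℝ)) :
    OracleProg E F A → ℕ
  | ret _ => 0
  | primal x y k => (k (OX x y)).primalCalls OX OY + 1
  | dual x y k => (k (OY x y)).primalCalls OX OY

/-- The number of calls to the dual oracle. -/
def dualCalls {A : Type*} (OX : E → F → (E →L[ℝ] ℝ)) (OY : E → F → (F →L[ℝ] ℝ)) :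
    OracleProg E F A → ℕ
  | ret _ => 0
  | primal x y k => (k (OX x y)).dualCalls OX OY
  | dual x y k => (k (OY x y)).dualCalls OX OY + 1

end OracleProg

/-! ### The (inexact) accelerated proximal gradient method -/

/-- Input of the accelerated proximal gradient method for
`min_{a ∈ U} h(a) + phi(a) + mu * omega(a)` with an `L`-smooth convex `h`. -/
structure APGInput (V : Type w) where
  U : Set V
  phi : V → ℝ
  omega : V → ℝ
  mu : ℝ
  L : ℝ

/-- State after `t` iterations: `cur = u^t`, `prev = u^{t-1}`, `hat = û^t`,
`wsum = ∑_{i=1}^t θ_i u^i` and `weight = ∑_{i=1}^t θ_i`. -/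
structure APGState (V : Type w) where
  cur : V
  prev : V
  hat : V
  wsum : V
  weight : ℝ

namespace APGInput

variable {V : Type w} [NormedAddCommGroup V] [NormedSpace ℝ V]

noncomputable def tau (I : APGInput V) : ℝ := √(I.L / I.mu)

noncomputable def eta (I : APGInput V) : ℝ := √(I.L * I.mu)

noncomputable def alpha (I : APGInput V) : ℝ := I.tau / (1 + I.tau)

/-- The averaging weight `θ_t = α^{-t}`. -/
noncomputable def theta (I : APGInput V) (t : ℕ) : ℝ := (I.alpha ^ t)⁻¹

/-- `argmin_{a ∈ U} phi(a) + mu * omega(a) + ⟨xi, a⟩ + eta * D_omega(a, b)`. -/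
noncomputable def prox (I : APGInput V) (xi : V →L[ℝ] ℝ) (b : V) : V :=
  argminOn I.U (fun a => I.phi a + I.mu * I.omega a + xi a + I.eta * bregman I.omega a b)

/-- The extrapolated and interpolated point `û^{t+1}` computed from the state after `t` steps:
`(ũ + τ û^t) / (1 + τ)` with `ũ = u^t + α (u^t - u^{t-1})`. -/
noncomputable def nextHat (I : APGInput V) (s : APGState V) : V :=
  (1 + I.tau)⁻¹ • ((I.alpha • (s.cur - s.prev) + s.cur) + I.tau • s.hat)

variable {E : Type u} {F : Type v} [NormedAddCommGroup E] [NormedSpace ℝ E]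
  [NormedAddCommGroup F] [NormedSpace ℝ F]

/-- The first `t` iterations, started at `u0`; `grad a` is the program that computes the (inexact)
gradient of `h` at `a`. -/
noncomputable def iterate (I : APGInput V) (grad : V → OracleProg E F (V →L[ℝ] ℝ)) (u0 : V) :
    ℕ → OracleProg E F (APGState V)
  | 0 => .ret ⟨u0, u0, u0, 0, 0⟩
  | t + 1 => (I.iterate grad u0 t).bind fun s =>
      (grad (I.nextHat s)).bind fun xi =>
        .ret ⟨I.prox xi s.cur, s.cur, I.nextHat s,
          s.wsum + I.theta (t + 1) • I.prox xi s.cur, s.weight + I.theta (t + 1)⟩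

/-- The method with `k` iterations: it returns the weighted average `(∑ θ_t)⁻¹ ∑ θ_t u^t`. -/
noncomputable def run (I : APGInput V) (grad : V → OracleProg E F (V →L[ℝ] ℝ)) (u0 : V) (k : ℕ) :
    OracleProg E F V :=
  (I.iterate grad u0 k).bind fun s => .ret (s.weight⁻¹ • s.wsum)

end APGInput

/-! ### The saddle-point problem -/

/-- The data of the saddle-point problem
`min_{x ∈ X} max_{y ∈ Y} mu ω_X(x) + r(x) + Ψ(x,y) - g(y) - ρ ω_Y(y)`
other than the coupling function `Ψ`, which a method can access through the oracles only. The
functions `r`, `g`, `omegaX`, `omegaY` enter through their values on `X` and `Y`, where they are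
finite; `domX` and `domY` are the effective domains of `omegaX` and `omegaY`. -/
structure SaddleData (E : Type u) (F : Type v) where
  X : Set E
  Y : Set F
  r : E → ℝ
  g : F → ℝ
  omegaX : E → ℝ
  domX : Set E
  omegaY : F → ℝ
  domY : Set F
  mu : ℝ
  Lxx : ℝ
  Lxy : ℝ
  Lyy : ℝ
  betaX : ℝ
  Mr : ℝ
  Mg : ℝ

namespace SaddleData

variable {E : Type u} {F : Type v} [NormedAddCommGroup E] [NormedSpace ℝ E]
  [NormedAddCommGroup F] [NormedSpace ℝ F]

/-- `∇ₓΨ(x, y)`. -/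
noncomputable def gradX (Psi : E → F → ℝ) (x : E) (y : F) : E →L[ℝ] ℝ :=
  fderiv ℝ (fun x' => Psi x' y) x

/-- `∇_yΨ(x, y)`. -/
noncomputable def gradY (Psi : E → F → ℝ) (x : E) (y : F) : F →L[ℝ] ℝ :=
  fderiv ℝ (fun y' => Psi x y') y

/-- `Ω = sup_{y ∈ Y} |ω_Y(y)|`. -/
noncomputable def Omega (D : SaddleData E F) : ℝ := sSup ((fun y => |D.omegaY y|) '' D.Y)

/-- `ψᴾ(x, y) = Ψ(x, y) + r(x) + mu ω_X(x)`. -/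
def psiP (D : SaddleData E F) (Psi : E → F → ℝ) (x : E) (y : F) : ℝ :=
  Psi x y + D.r x + D.mu * D.omegaX x

/-- `ψᴰ_ρ(x, y) = Ψ(x, y) - g(y) - ρ ω_Y(y)`. -/
def psiD (D : SaddleData E F) (Psi : E → F → ℝ) (rho : ℝ) (x : E) (y : F) : ℝ :=
  Psi x y - D.g y - rho * D.omegaY y

/-- `f_ρ(x) = max_{y ∈ Y} ψᴰ_ρ(x, y)`. -/
noncomputable def fbar (D : SaddleData E F) (Psi : E → F → ℝ) (rho : ℝ) (x : E) : ℝ :=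
  sSup ((fun y => D.psiD Psi rho x y) '' D.Y)

/-- The primal function `p_ρ`. -/
noncomputable def primalFn (D : SaddleData E F) (Psi : E → F → ℝ) (rho : ℝ) (x : E) : ℝ :=
  D.fbar Psi rho x + D.r x + D.mu * D.omegaX x

/-- The optimal primal value `p_ρ* = min_X p_ρ`. -/
noncomputable def primalOpt (D : SaddleData E F) (Psi : E → F → ℝ) (rho : ℝ) : ℝ :=
  sInf (D.primalFn Psi rho '' D.X)

/-- `π(y) = min_{x ∈ X} ψᴾ(x, y)`. -/
noncomputable def piFn (D : SaddleData E F) (Psi : E → F → ℝ) (y : F) : ℝ :=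
  sInf ((fun x => D.psiP Psi x y) '' D.X)

/-- The dual function `d_ρ`. -/
noncomputable def dualFn (D : SaddleData E F) (Psi : E → F → ℝ) (rho : ℝ) (y : F) : ℝ :=
  D.piFn Psi y - D.g y - rho * D.omegaY y

/-- The optimal dual value `d_ρ* = max_Y d_ρ`. -/
noncomputable def dualOpt (D : SaddleData E F) (Psi : E → F → ℝ) (rho : ℝ) : ℝ :=
  sSup (D.dualFn Psi rho '' D.Y)

/-- The duality gap `Δ_ρ(x, y) = p_ρ(x) - d_ρ(y)`; `Δ = Δ_0`. -/
noncomputable def gap (D : SaddleData E F) (Psi : E → F → ℝ) (rho : ℝ) (x : E) (y : F) : ℝ :=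
  D.primalFn Psi rho x - D.dualFn Psi rho y

/-- The assumptions on the saddle-point problem. -/
structure Standing (D : SaddleData E F) (Psi : E → F → ℝ) : Prop where
  X_nonempty : D.X.Nonempty
  X_closed : IsClosed D.X
  X_convex : Convex ℝ D.X
  Y_nonempty : D.Y.Nonempty
  Y_closed : IsClosed D.Y
  Y_convex : Convex ℝ D.Y
  Y_bounded : Bornology.IsBounded D.Y
  -- `r` and `g` are convex and Lipschitz on `X` and `Y`
  r_convex : ConvexOn ℝ D.X D.r
  Mr_nonneg : 0 ≤ D.Mr
  r_lipschitz : ∀ x ∈ D.X, ∀ x' ∈ D.X, |D.r x - D.r x'| ≤ D.Mr * ‖x - x'‖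
  g_convex : ConvexOn ℝ D.Y D.g
  Mg_nonneg : 0 ≤ D.Mg
  g_lipschitz : ∀ y ∈ D.Y, ∀ y' ∈ D.Y, |D.g y - D.g y'| ≤ D.Mg * ‖y - y'‖
  -- the distance generating functions; `ω_X` is differentiable around `X` with Lipschitz gradient
  omegaX_dgf : IsDGF D.X D.domX D.omegaX
  X_subset : D.X ⊆ interior D.domX
  betaX_ge : 1 ≤ D.betaX
  omegaX_smooth : ∀ x ∈ D.X, ∀ x' ∈ D.X,
    ‖fderiv ℝ D.omegaX x - fderiv ℝ D.omegaX x'‖ ≤ D.betaX * ‖x - x'‖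
  omegaY_dgf : IsDGF D.Y D.domY D.omegaY
  Omega_pos : 0 < D.Omega
  -- the Bregman proximal projections exist
  r_bpp : HasBPP D.X D.domX D.omegaX D.r
  g_bpp : HasBPP D.Y D.domY D.omegaY D.g
  -- the constants
  mu_pos : 0 < D.mu
  mu_le : D.mu ≤ D.Lxx
  Lxy_pos : 0 < D.Lxy
  Lyy_nonneg : 0 ≤ D.Lyy
  -- the coupling function
  Psi_continuous : ContinuousOn (fun z : E × F => Psi z.1 z.2) (D.X ×ˢ D.Y)
  Psi_diffX : ∀ x ∈ D.X, ∀ y ∈ D.Y, DifferentiableAt ℝ (fun x' => Psi x' y) x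
  Psi_convex : ∀ x ∈ D.X, ∀ x' ∈ D.X, ∀ y ∈ D.Y,
    0 ≤ Psi x' y - Psi x y - gradX Psi x y (x' - x)
  Psi_smoothXX : ∀ x ∈ D.X, ∀ x' ∈ D.X, ∀ y ∈ D.Y,
    Psi x' y - Psi x y - gradX Psi x y (x' - x) ≤ D.Lxx / 2 * ‖x' - x‖ ^ 2
  Psi_smoothXY : ∀ x ∈ D.X, ∀ y ∈ D.Y, ∀ y' ∈ D.Y,
    ‖gradX Psi x y - gradX Psi x y'‖ ≤ D.Lxy * ‖y - y'‖
  Psi_concave : ∀ x ∈ D.X, ConcaveOn ℝ D.Y (Psi x)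
  Psi_diffY : ∀ x ∈ D.X, ∀ y ∈ D.Y, DifferentiableAt ℝ (fun y' => Psi x y') y
  Psi_smoothYX : ∀ x ∈ D.X, ∀ x' ∈ D.X, ∀ y ∈ D.Y,
    ‖gradY Psi x y - gradY Psi x' y‖ ≤ D.Lxy * ‖x - x'‖
  Psi_smoothYY : ∀ x ∈ D.X, ∀ y ∈ D.Y, ∀ y' ∈ D.Y,
    ‖gradY Psi x y - gradY Psi x y'‖ ≤ D.Lyy * ‖y - y'‖

/-- `OX` is a primal first-order oracle: it answers `∇ₓΨ(x, y)` on `X × Y` (and anything off it). -/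
def IsPrimalOracle (D : SaddleData E F) (Psi : E → F → ℝ) (OX : E → F → (E →L[ℝ] ℝ)) : Prop :=
  ∀ x ∈ D.X, ∀ y ∈ D.Y, OX x y = gradX Psi x y

/-- `OY` is a dual first-order oracle: it answers `∇_yΨ(x, y)` on `X × Y` (and anything off it). -/
def IsDualOracle (D : SaddleData E F) (Psi : E → F → ℝ) (OY : E → F → (F →L[ℝ] ℝ)) : Prop :=
  ∀ x ∈ D.X, ∀ y ∈ D.Y, OY x y = gradY Psi x y

/-! ### Parameters of the dual-smoothing method -/

/-- The smoothing parameter `ρ = ε / (4 Ω)`. -/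
noncomputable def rho (D : SaddleData E F) (eps : ℝ) : ℝ := eps / (4 * D.Omega)

/-- `L_π = L_yy + L_xy² / mu`. -/
noncomputable def Lpi (D : SaddleData E F) : ℝ := D.Lyy + D.Lxy ^ 2 / D.mu

/-- `L'_ρ = L'_xx + L_xy² / ρ`. -/
noncomputable def Lrho (D : SaddleData E F) (rho : ℝ) : ℝ := D.Lxx + D.Lxy ^ 2 / rho

/-- The bound `B_ρ(f_ρ)` computed from the reference point `xh`. -/
noncomputable def boundF (D : SaddleData E F) (Psi : E → F → ℝ) (xh : E) (rho : ℝ) : ℝ :=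
  D.Lxy * Metric.diam D.Y + sSup ((fun y => ‖gradX Psi xh y‖) '' D.Y)
    + D.Lxx / √D.mu * (1 + D.Lxy / √D.mu + 2 * √D.Omega)
    + 2 * D.Lrho rho * √(rho * D.Omega / D.mu)

/-- The bound `B_ρ(ω_X)` computed from the reference point `xh`. -/
noncomputable def boundOmega (D : SaddleData E F) (xh : E) (rho : ℝ) : ℝ :=
  ‖fderiv ℝ D.omegaX xh‖
    + D.betaX / √D.mu * (1 + D.Lxy / √D.mu + 2 * √D.Omega * (1 + √rho))

/-- The factor shared by the two accuracies below. -/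
noncomputable def accFactor (D : SaddleData E F) (Psi : E → F → ℝ) (xh : E) (rho eps : ℝ) : ℝ :=
  min (eps / (8 * (D.boundF Psi xh rho + D.Mr + D.boundOmega xh rho) ^ 2))
    (1 / (D.Lrho rho + D.betaX))

/-- The accuracy `ε₃` of the dual problem. -/
noncomputable def eps3 (D : SaddleData E F) (Psi : E → F → ℝ) (xh : E) (rho eps : ℝ) : ℝ :=
  min (eps * D.mu ^ 2 * rho / (64 * D.Lxy ^ 2) * D.accFactor Psi xh rho eps) (eps / 4)

/-- The accuracy `ε₄` of the last primal subproblem. -/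
noncomputable def eps4 (D : SaddleData E F) (Psi : E → F → ℝ) (xh : E) (rho eps : ℝ) : ℝ :=
  eps * D.mu / 64 * D.accFactor Psi xh rho eps

/-- The accuracy `δ₂` of the primal subproblems needed to solve the dual problem to accuracy `e`. -/
noncomputable def delta2 (D : SaddleData E F) (rho e : ℝ) : ℝ :=
  e * D.mu * rho ^ (3 / 2 : ℝ)
    / ((14 * √2) ^ 2 * D.Lxy ^ 2 * √D.Lpi * (1 + √(D.Lpi / rho)) ^ 2)

/-- `(xh, yh)` is a reference pair: `yh` is a `1/2`-optimal solution of the dual problem with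
`ρ = 1`, and `xh` is a `1/2`-optimal solution of `min_{x ∈ X} ψᴾ(x, yh)`. -/
def IsReference (D : SaddleData E F) (Psi : E → F → ℝ) (xh : E) (yh : F) : Prop :=
  xh ∈ D.X ∧ yh ∈ D.Y ∧ D.dualOpt Psi 1 - D.dualFn Psi 1 yh ≤ 1 / 2 ∧
    D.psiP Psi xh yh - D.piFn Psi yh ≤ 1 / 2

/-! ### The dual-smoothing method -/

/-- `n` steps of the exact accelerated method, from `x0`, on the subproblem
`min_{x ∈ X} Ψ(x, y) + r(x) + mu ω_X(x)`; every step calls the primal oracle once. -/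
noncomputable def primalSolver (D : SaddleData E F) (x0 : E) (n : ℕ) (y : F) : OracleProg E F E :=
  APGInput.run ⟨D.X, D.r, D.omegaX, D.mu, D.Lxx⟩
    (fun x => .primal x y fun xi => .ret xi) x0 n

/-- `k` steps of the inexact accelerated method, from `y0`, on the dual problem
`min_{y ∈ Y} -π(y) + g(y) + ρ ω_Y(y)`. The inexact gradient of `-π` at `y` is `-∇_yΨ(x, y)`, where
`x` is computed by `n` steps of the primal solver. -/
noncomputable def dualSolver (D : SaddleData E F) (rho : ℝ) (x0 : E) (y0 : F) (k n : ℕ) :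
    OracleProg E F F :=
  APGInput.run ⟨D.Y, D.g, D.omegaY, rho, D.Lpi⟩
    (fun y => (D.primalSolver x0 n y).bind fun x => .dual x y fun xi => .ret (-xi)) y0 k

/-- The dual-smoothing method: `k` steps of the dual solver, with `n` inner steps each, give `y`;
then `m` steps of the primal solver at `y` give `x`; the pair `(x, y)` is returned. -/
noncomputable def method (D : SaddleData E F) (rho : ℝ) (x0 : E) (y0 : F) (k n m : ℕ) :
    OracleProg E F (E × F) :=
  (D.dualSolver rho x0 y0 k n).bind fun y =>
    (D.primalSolver x0 m y).bind fun x => .ret (x, y)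

end SaddleData

/-! Part (a) is a perturbation estimate at the saddle point (xs, ys) of the smoothed problem. Since
d_ρ is ρ-strongly concave and ψᴾ(·, y) is μ-strongly convex, the accuracies ε₃ and ε₄ bound ‖y - ys‖
and ‖x - x*(y)‖. The minimizer map x* is L_xy/μ-Lipschitz (`xstar_lipschitz`), so ‖x - xs‖ is small
as well, and so is the distance from ys to the best response to x (`ybest_sub_ystar_le`). Hence
p_ρ(x) exceeds d_ρ* by at most the inner accuracy plus a term of second order in these distances
(`primalFn_sub_dualOpt_le`), and κ ≤ 1/(L'_ρ + β_X) makes this term at most ε/8. Weak duality then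
gives the primal claim, and the smoothing bias 2ρΩ = ε/2 gives the gap. No minimax theorem is
needed: the saddle property comes from first-order optimality of ys for the smooth concave function
π (`psiD_le_of_saddle`).

Part (b) rests on a Lyapunov function for the accelerated method (`iterate_lyapunov`) that contracts
by the factor α in every step. A gradient error adds only (1 - α)σ per step, so errors sum to at
most σ and do not accumulate; `run_spec` turns this into linear convergence of the averaged output.
The inner problem is solved with exact gradients. The outer one has the L_π-smooth function -π
(`isSmoothConvexOn_neg_piFn`), and an inner accuracy s² yields a gradient error of order s, by
quadratic growth.

The convergence constants depend on the instance, yet C is universal. Every accuracy in play is at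
least cε^N on (0, 1], with explicit N and an instance-dependent c (`LowerPow`). So log(K/accuracy) ≤
(N + 1) log(1/ε) once ε is small (`LowerPow.log_div_le`), and instance data move only the threshold
ε₀. The remaining factors 1 + √(L_π/ρ) and 1 + √(L'_xx/μ) are the numbers of steps per unit of
logarithm. -/

/-! ### Strong convexity and Bregman divergences -/

section Convex

variable {V : Type*} [NormedAddCommGroup V] [NormedSpace ℝ V]

/-- A minimizer of a strongly convex function has quadratic growth. -/
theorem StrongConvexOn.quadratic_growth {U : Set V} {m : ℝ} {f : V → ℝ}
    (hf : StrongConvexOn U m f) {a b : V} (ha : a ∈ U) (hmin : ∀ c ∈ U, f a ≤ f c) (hb : b ∈ U) :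
    m / 2 * ‖b - a‖ ^ 2 ≤ f b - f a := by
  set c := m / 2 * ‖b - a‖ ^ 2 with hc
  have key : ∀ t : ℝ, 0 < t → t ≤ 1 → (1 - t) * c ≤ f b - f a := by
    intro t ht ht1
    have h1 := hf.2 hb ha ht.le (sub_nonneg.2 ht1) (by ring)
    have h2 := hmin _ (hf.1 hb ha ht.le (sub_nonneg.2 ht1) (by ring))
    simp only [smul_eq_mul] at h1
    have h3 : t * ((1 - t) * c) ≤ t * (f b - f a) := by
      rw [hc]; nlinarith
    exact le_of_mul_le_mul_left h3 ht
  have h0 : 0 ≤ f b - f a := sub_nonneg.2 (hmin b hb)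
  by_contra! hlt
  have hcpos : 0 < c := h0.trans_lt hlt
  -- This t makes (1 - t)c the midpoint of c and f b - f a, which exceeds f b - f a.
  have h := key ((c - (f b - f a)) / (2 * c)) (by apply div_pos <;> linarith)
    (by rw [div_le_one (by linarith)]; linarith)
  have h4 : (1 - (c - (f b - f a)) / (2 * c)) * c = (c + (f b - f a)) / 2 := by
    field_simp; ring
  linarith

/-- The difference quotients from the right are at least c. This is the one-sided first-order test
behind all later optimality conditions on segments, where only points of a convex set may be
compared. -/
theorem HasDerivAt.le_of_forall_linear_le {f : ℝ → ℝ} {f' c : ℝ} (hf : HasDerivAt f f' 0)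
    (h : ∀ t : ℝ, 0 < t → t ≤ 1 → f 0 + t * c ≤ f t) : c ≤ f' := by
  have h1 : Tendsto (slope f 0) (𝓝[>] 0) (𝓝 f') :=
    (hasDerivAt_iff_tendsto_slope.1 hf).mono_left
      (nhdsWithin_mono _ (fun x hx => ne_of_gt hx))
  refine ge_of_tendsto h1 ?_
  filter_upwards [Ioc_mem_nhdsGT (zero_lt_one' ℝ)] with t ht
  rw [slope_def_field, sub_zero, le_div_iff₀ ht.1]
  linarith [h t ht.1 ht.2]

theorem HasFDerivAt.hasDerivAt_line {f : V → ℝ} {f' : V →L[ℝ] ℝ} {p : V}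
    (hf : HasFDerivAt f f' p) (v : V) : HasDerivAt (fun t : ℝ => f (p + t • v)) (f' v) 0 := by
  have h : HasDerivAt (fun t : ℝ => p + t • v) v 0 := by
    simpa using ((hasDerivAt_id (0 : ℝ)).smul_const v).const_add p
  exact HasFDerivAt.comp_hasDerivAt (0 : ℝ) (by simpa using hf) h

theorem Convex.add_smul_sub_mem_of_le {U : Set V} (hU : Convex ℝ U) {a b : V} (ha : a ∈ U)
    (hb : b ∈ U) {t : ℝ} (h0 : 0 ≤ t) (h1 : t ≤ 1) : b + t • (a - b) ∈ U :=
  hU.add_smul_sub_mem hb ha ⟨h0, h1⟩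

theorem add_smul_sub_eq (a b : V) (t : ℝ) : b + t • (a - b) = t • a + (1 - t) • b := by
  module

/-- A strongly convex function lies above its tangents, with a quadratic gap. -/
theorem StrongConvexOn.half_sq_le_of_hasFDerivAt {U : Set V} {m : ℝ} {f : V → ℝ}
    (hf : StrongConvexOn U m f) {a b : V} (ha : a ∈ U) (hb : b ∈ U) {f' : V →L[ℝ] ℝ}
    (hd : HasFDerivAt f f' b) : m / 2 * ‖a - b‖ ^ 2 ≤ f a - f b - f' (a - b) := by
  set N := m / 2 * ‖a - b‖ ^ 2 with hN
  have h1 := hd.hasDerivAt_line (a - b)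
  have h2 : HasDerivAt (fun t : ℝ => t ^ 2 * N) 0 0 := by
    simpa using ((hasDerivAt_id (0 : ℝ)).pow 2).mul_const N
  have h3 := h2.sub h1
  have := h3.le_of_forall_linear_le (c := -(f a - f b - N)) ?_
  · linarith
  · intro t ht ht1
    have h4 := hf.2 ha hb ht.le (sub_nonneg.2 ht1) (by ring)
    rw [← add_smul_sub_eq] at h4
    simp only [smul_eq_mul] at h4
    simp only [Pi.sub_apply, zero_smul, add_zero]
    rw [hN] at *
    nlinarith

theorem IsDGF.hasFDerivAt {U dom : Set V} {omega : V → ℝ} (h : IsDGF U dom omega) {b : V}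
    (hb : b ∈ interior dom) : HasFDerivAt omega (fderiv ℝ omega b) b :=
  ((h.contDiffOn.differentiableOn (by norm_num)).differentiableAt
    (isOpen_interior.mem_nhds hb)).hasFDerivAt

theorem IsDGF.half_sq_le_bregman {U dom : Set V} {omega : V → ℝ} (h : IsDGF U dom omega) {a b : V}
    (ha : a ∈ U) (hb : b ∈ U ∩ interior dom) : 1 / 2 * ‖a - b‖ ^ 2 ≤ bregman omega a b :=
  h.strongConvexOn.half_sq_le_of_hasFDerivAt ha hb.1 (h.hasFDerivAt hb.2)

theorem IsDGF.bregman_nonneg {U dom : Set V} {omega : V → ℝ} (h : IsDGF U dom omega) {a b : V}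
    (ha : a ∈ U) (hb : b ∈ U ∩ interior dom) : 0 ≤ bregman omega a b :=
  le_trans (by positivity) (h.half_sq_le_bregman ha hb)

/-- The three-point inequality for a Bregman proximal step. -/
theorem IsDGF.three_point {U dom : Set V} {omega phi : V → ℝ} (h : IsDGF U dom omega)
    (hphi : ConvexOn ℝ U phi) {nu eta : ℝ} {xi : V →L[ℝ] ℝ} {b p a : V}
    (hp : p ∈ U ∩ interior dom) (ha : a ∈ U)
    (hmin : ∀ c ∈ U, phi p + nu * omega p + xi p + eta * bregman omega p b ≤
      phi c + nu * omega c + xi c + eta * bregman omega c b) :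
    phi p + nu * omega p + xi p + eta * bregman omega p b + (nu + eta) * bregman omega a p ≤
      phi a + nu * omega a + xi a + eta * bregman omega a b := by
  have hd := h.hasFDerivAt hp.2
  have hS : HasFDerivAt (fun c => nu * omega c + xi c + eta * bregman omega c b)
      (nu • fderiv ℝ omega p + xi + eta • (fderiv ℝ omega p - fderiv ℝ omega b)) p := by
    refine ((hd.const_mul nu).add xi.hasFDerivAt).add (HasFDerivAt.const_mul ?_ eta)
    refine (hd.sub_const (omega b)).sub ?_
    exact (fderiv ℝ omega b).hasFDerivAt.comp p ((hasFDerivAt_id p).sub_const b)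
  -- First-order optimality of p on the segment towards a: the possibly nonsmooth phi is handled by
  -- convexity, and only the remaining terms are differentiated.
  have h1 := (hS.hasDerivAt_line (a - p)).le_of_forall_linear_le (c := phi p - phi a) ?_
  · simp only [add_apply, smul_apply,
      sub_apply, smul_eq_mul, map_sub] at h1
    simp only [bregman, map_sub]
    linarith
  · intro t ht ht1
    have h4 := hphi.2 ha hp.1 ht.le (sub_nonneg.2 ht1) (by ring)
    have h5 := hmin _ (hphi.1.add_smul_sub_mem_of_le ha hp.1 ht.le ht1)
    rw [← add_smul_sub_eq] at h4
    simp only [smul_eq_mul] at h4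
    simp only [zero_smul, add_zero]
    linarith

theorem argminOn_spec {V : Type*} [Zero V] {U : Set V} {f : V → ℝ}
    (h : ∃ p, p ∈ U ∧ ∀ b ∈ U, f p ≤ f b) :
    argminOn U f ∈ U ∧ ∀ b ∈ U, f (argminOn U f) ≤ f b := by
  unfold argminOn
  rw [dif_pos h]
  exact h.choose_spec

/-- `h` is convex and `L`-smooth on `U`, with gradient `G`. -/
def IsSmoothConvexOn (U : Set V) (h : V → ℝ) (G : V → V →L[ℝ] ℝ) (L : ℝ) : Prop :=
  ∀ a ∈ U, ∀ b ∈ U, 0 ≤ h b - h a - G a (b - a) ∧ h b - h a - G a (b - a) ≤ L / 2 * ‖b - a‖ ^ 2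

/-- Average the two tangent inequalities at the convex combination; their linear terms cancel. -/
theorem IsSmoothConvexOn.convexOn {U : Set V} {h : V → ℝ} {G : V → V →L[ℝ] ℝ} {L : ℝ}
    (hs : IsSmoothConvexOn U h G L) (hU : Convex ℝ U) : ConvexOn ℝ U h := by
  refine ⟨hU, fun a ha b hb s t hs0 ht0 hst => ?_⟩
  have hc := hU ha hb hs0 ht0 hst
  have h1 := (hs _ hc a ha).1
  have h2 := (hs _ hc b hb).1
  set c := s • a + t • b with hcdef
  have h3 : s * G c (a - c) + t * G c (b - c) = 0 := by
    rw [← smul_eq_mul, ← smul_eq_mul, ← map_smul, ← map_smul, ← map_add]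
    have : s • (a - c) + t • (b - c) = 0 := by
      have : s • (a - c) + t • (b - c) = (s • a + t • b) - (s + t) • c := by module
      rw [this, hst, one_smul, hcdef, sub_self]
    rw [this, map_zero]
  simp only [smul_eq_mul]
  have h4 : h c = (s + t) * h c := by rw [hst, one_mul]
  rw [h4]
  nlinarith [mul_nonneg hs0 h1, mul_nonneg ht0 h2]

end Convex

/-! ### Programs -/

namespace OracleProg

variable {E : Type u} {F : Type v} [NormedAddCommGroup E] [NormedSpace ℝ E]
  [NormedAddCommGroup F] [NormedSpace ℝ F]
  (OX : E → F → (E →L[ℝ] ℝ)) (OY : E → F → (F →L[ℝ] ℝ))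

theorem result_bind {A B : Type*} (p : OracleProg E F A) (f : A → OracleProg E F B) :
    (p.bind f).result OX OY = (f (p.result OX OY)).result OX OY := by
  induction p with
  | ret a => rfl
  | primal x y k ih => exact ih _
  | dual x y k ih => exact ih _

theorem primalCalls_bind {A B : Type*} (p : OracleProg E F A) (f : A → OracleProg E F B) :
    (p.bind f).primalCalls OX OY
      = p.primalCalls OX OY + (f (p.result OX OY)).primalCalls OX OY := by
  induction p with
  | ret a => simp [bind, primalCalls, result]
  | primal x y k ih => simp only [bind, primalCalls, result, ih]; ring
  | dual x y k ih => simp only [bind, primalCalls, result, ih]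

theorem dualCalls_bind {A B : Type*} (p : OracleProg E F A) (f : A → OracleProg E F B) :
    (p.bind f).dualCalls OX OY = p.dualCalls OX OY + (f (p.result OX OY)).dualCalls OX OY := by
  induction p with
  | ret a => simp [bind, dualCalls, result]
  | primal x y k ih => simp only [bind, dualCalls, result, ih]
  | dual x y k ih => simp only [bind, dualCalls, result, ih]; ring

end OracleProg

/-! ### Convergence of the inexact accelerated proximal gradient method -/

namespace APGInput

variable {V : Type w}

theorem tau_pos (I : APGInput V) (hmu : 0 < I.mu) (hL : 0 < I.L) : 0 < I.tau :=
  Real.sqrt_pos.2 (div_pos hL hmu)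

theorem alpha_pos (I : APGInput V) (hmu : 0 < I.mu) (hL : 0 < I.L) : 0 < I.alpha :=
  div_pos (I.tau_pos hmu hL) (by linarith [I.tau_pos hmu hL])

theorem one_sub_alpha (I : APGInput V) (hmu : 0 < I.mu) (hL : 0 < I.L) :
    1 - I.alpha = (1 + I.tau)⁻¹ := by
  have := I.tau_pos hmu hL
  unfold alpha
  field_simp
  ring

theorem alpha_lt_one (I : APGInput V) (hmu : 0 < I.mu) (hL : 0 < I.L) : I.alpha < 1 := by
  have h := I.one_sub_alpha hmu hL
  have : 0 < (1 + I.tau)⁻¹ := inv_pos.2 (by linarith [I.tau_pos hmu hL])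
  linarith

theorem eta_eq (I : APGInput V) (hmu : 0 < I.mu) : I.eta = I.mu * I.tau := by
  unfold eta tau
  rw [← Real.sqrt_sq hmu.le, ← Real.sqrt_mul (sq_nonneg _), Real.sqrt_sq hmu.le]
  congr 1
  field_simp

theorem eta_pos (I : APGInput V) (hmu : 0 < I.mu) (hL : 0 < I.L) : 0 < I.eta :=
  Real.sqrt_pos.2 (mul_pos hL hmu)

theorem one_sub_alpha_mul_add (I : APGInput V) (hmu : 0 < I.mu) (hL : 0 < I.L) :
    (1 - I.alpha) * (I.mu + I.eta) = I.mu := by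
  have := I.tau_pos hmu hL
  rw [I.one_sub_alpha hmu hL, I.eta_eq hmu]
  field_simp

theorem one_sub_alpha_mul_eta (I : APGInput V) (hmu : 0 < I.mu) (hL : 0 < I.L) :
    (1 - I.alpha) * I.eta = I.alpha * I.mu := by
  linarith [I.one_sub_alpha_mul_add hmu hL]

/-- With L = μτ² this reduces to τ ≤ 1 + τ. It lets the Bregman term of the proximal step absorb the
smoothness error of an accelerated step. -/
theorem L_mul_one_sub_alpha_sq_le (I : APGInput V) (hmu : 0 < I.mu) (hL : 0 < I.L) :
    I.L * (1 - I.alpha) ^ 2 ≤ I.alpha * I.mu := by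
  have ht := I.tau_pos hmu hL
  have h1 : I.tau ^ 2 = I.L / I.mu := Real.sq_sqrt (div_pos hL hmu).le
  have h2 : I.L = I.mu * I.tau ^ 2 := by rw [h1]; field_simp
  rw [I.one_sub_alpha hmu hL, h2]
  unfold alpha
  rw [inv_pow, ← div_eq_mul_inv, div_mul_eq_mul_div,
    div_le_div_iff₀ (by positivity) (by positivity)]
  have : 0 ≤ I.mu * I.tau * (1 + I.tau) := by positivity
  nlinarith

theorem alpha_pow_le_exp (I : APGInput V) (hmu : 0 < I.mu) (hL : 0 < I.L) (k : ℕ) :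
    I.alpha ^ k ≤ Real.exp (-(k / (1 + I.tau))) := by
  have h1 : I.alpha ≤ Real.exp (-(1 + I.tau)⁻¹) := by
    have := Real.add_one_le_exp (-(1 + I.tau)⁻¹)
    linarith [I.one_sub_alpha hmu hL]
  calc I.alpha ^ k ≤ Real.exp (-(1 + I.tau)⁻¹) ^ k :=
        pow_le_pow_left₀ (I.alpha_pos hmu hL).le h1 k
    _ = Real.exp (-(k / (1 + I.tau))) := by
        rw [← Real.exp_nat_mul]; congr 1; ring

variable [NormedAddCommGroup V] [NormedSpace ℝ V]

theorem prox_spec (I : APGInput V) {dom : Set V} (hmu : 0 < I.mu) (hL : 0 < I.L)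
    (hbpp : HasBPP I.U dom I.omega I.phi) (xi : V →L[ℝ] ℝ) {b : V} (hb : b ∈ I.U ∩ interior dom) :
    I.prox xi b ∈ I.U ∩ interior dom ∧ ∀ a ∈ I.U,
      I.phi (I.prox xi b) + I.mu * I.omega (I.prox xi b) + xi (I.prox xi b)
          + I.eta * bregman I.omega (I.prox xi b) b ≤
        I.phi a + I.mu * I.omega a + xi a + I.eta * bregman I.omega a b := by
  have hpos : 0 < I.mu + I.eta := add_pos hmu (I.eta_pos hmu hL)
  -- Up to a constant, μω equals μD_ω(·, b) plus the linear form μ∇ω(b). So the step with μω and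
  -- ηD_ω is a Bregman projection with weight μ + η.
  obtain ⟨p, hp, hmin⟩ := hbpp b hb (xi + I.mu • fderiv ℝ I.omega b) (I.mu + I.eta)⁻¹
    (inv_pos.2 hpos)
  simp only [inv_inv] at hmin
  have hmin' : ∀ a ∈ I.U, a ≠ p →
      I.phi p + I.mu * I.omega p + xi p + I.eta * bregman I.omega p b <
        I.phi a + I.mu * I.omega a + xi a + I.eta * bregman I.omega a b := by
    intro a ha hap
    have := hmin a ha hap
    simp only [bregman, map_sub, add_apply, smul_apply,
      smul_eq_mul] at this ⊢
    linarith
  have hle : ∀ a ∈ I.U, I.phi p + I.mu * I.omega p + xi p + I.eta * bregman I.omega p b ≤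
        I.phi a + I.mu * I.omega a + xi a + I.eta * bregman I.omega a b := by
    intro a ha
    by_cases hap : a = p
    · rw [hap]
    · exact (hmin' a ha hap).le
  have hspec := argminOn_spec (U := I.U)
    (f := fun a => I.phi a + I.mu * I.omega a + xi a + I.eta * bregman I.omega a b) ⟨p, hp.1, hle⟩
  change I.prox xi b ∈ I.U ∧ _ at hspec
  -- Strict minimality identifies the chosen minimizer with p, so it lies in the interior of the
  -- domain and can serve as the next Bregman centre.
  have heq : I.prox xi b = p := by
    by_contra hne
    exact absurd (hspec.2 p hp.1) (not_le.2 (hmin' _ hspec.1 hne))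
  exact ⟨heq ▸ hp, hspec.2⟩

variable {E : Type u} {F : Type v} [NormedAddCommGroup E] [NormedSpace ℝ E]
  [NormedAddCommGroup F] [NormedSpace ℝ F]
  (OX : E → F → (E →L[ℝ] ℝ)) (OY : E → F → (F →L[ℝ] ℝ))

theorem iterate_succ_result (I : APGInput V) (grad : V → OracleProg E F (V →L[ℝ] ℝ)) (u0 : V)
    (t : ℕ) : (I.iterate grad u0 (t + 1)).result OX OY =
      (fun (s : APGState V) (xi : V →L[ℝ] ℝ) =>
        (⟨I.prox xi s.cur, s.cur, I.nextHat s, s.wsum + I.theta (t + 1) • I.prox xi s.cur,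
          s.weight + I.theta (t + 1)⟩ : APGState V))
        ((I.iterate grad u0 t).result OX OY)
        ((grad (I.nextHat ((I.iterate grad u0 t).result OX OY))).result OX OY) := by
  rw [iterate, OracleProg.result_bind, OracleProg.result_bind]
  rfl

/-- The Lyapunov inequality of the method, after `t` steps. The point `z` is the usual averaged
sequence of an accelerated method, and `p` is the output. -/
theorem iterate_lyapunov (I : APGInput V) {dom : Set V} {h : V → ℝ} {G : V → V →L[ℝ] ℝ}
    {sigma : ℝ} (hmu : 0 < I.mu) (hL : 0 < I.L) (hU : Convex ℝ I.U)
    (hdgf : IsDGF I.U dom I.omega) (hphi : ConvexOn ℝ I.U I.phi)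
    (hbpp : HasBPP I.U dom I.omega I.phi) (hh : IsSmoothConvexOn I.U h G I.L)
    (grad : V → OracleProg E F (V →L[ℝ] ℝ))
    (hgrad : ∀ a ∈ I.U, ∀ b ∈ I.U, ∀ c ∈ I.U, ((grad a).result OX OY - G a) (b - c) ≤ sigma)
    {u0 : V} (hu0 : u0 ∈ I.U ∩ interior dom) {q : V} (hq : q ∈ I.U) (t : ℕ) :
    ((I.iterate grad u0 t).result OX OY).cur ∈ I.U ∩ interior dom ∧
    ∃ z ∈ I.U, ∃ p ∈ I.U, ∃ A : ℝ,
      z = ((I.iterate grad u0 t).result OX OY).hat + (1 - I.alpha) •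
        (((I.iterate grad u0 t).result OX OY).cur - ((I.iterate grad u0 t).result OX OY).prev) ∧
      z = (1 - I.alpha ^ t) • p + I.alpha ^ t • u0 ∧
      (1 - I.alpha ^ t) • p
        = ((1 - I.alpha) * I.alpha ^ t) • ((I.iterate grad u0 t).result OX OY).wsum ∧
      (1 - I.alpha) * I.alpha ^ t * ((I.iterate grad u0 t).result OX OY).weight
        = 1 - I.alpha ^ t ∧
      (1 - I.alpha ^ t) * (I.phi p + I.mu * I.omega p) ≤ A ∧
      h z + A + I.mu * bregman I.omega q ((I.iterate grad u0 t).result OX OY).cur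
          - (h q + I.phi q + I.mu * I.omega q) ≤
        I.alpha ^ t * (h u0 + I.mu * bregman I.omega q u0 - (h q + I.phi q + I.mu * I.omega q))
          + (1 - I.alpha ^ t) * sigma := by
  have ha0 := I.alpha_pos hmu hL
  have ha1 := I.alpha_lt_one hmu hL
  set al := I.alpha with hal
  induction t with
  | zero =>
    -- Before the first step the average p has weight 0, so any point of U will do, and A = 0.
    refine ⟨hu0, u0, hu0.1, u0, hu0.1, 0, ?_, ?_, ?_, ?_, ?_, ?_⟩ <;>
      simp [iterate, OracleProg.result]
  | succ t ih =>
    obtain ⟨hcur, z, hz, p, hp, A, hz1, hz2, hp1, hw, hA, hV⟩ := ih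
    rw [iterate_succ_result]
    set s := (I.iterate grad u0 t).result OX OY with hs
    -- The extrapolated point may leave U, but the query point is a convex combination of z and u^t,
    -- both in U.
    have hhat : I.nextHat s = al • z + (1 - al) • s.cur := by
      have ht : I.tau = al * (1 + I.tau) := by
        rw [hal]; unfold alpha; have := I.tau_pos hmu hL; field_simp
      have h1 := I.one_sub_alpha hmu hL
      have h2 : (1 + I.tau)⁻¹ * I.tau = al := by
        rw [hal]; unfold alpha; rw [div_eq_mul_inv, mul_comm]
      unfold nextHat
      rw [smul_add, smul_smul, h2, ← h1, hz1, ← hal]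
      module
    have hhatU : I.nextHat s ∈ I.U := by
      rw [hhat]; exact hU hz hcur.1 ha0.le (by linarith) (by ring)
    set a := I.nextHat s with ha
    set xi := (grad a).result OX OY with hxi
    obtain ⟨hc', hmin⟩ := I.prox_spec hmu hL hbpp xi hcur
    set c := I.prox xi s.cur with hc
    have h3 := hdgf.three_point hphi hc' hq hmin
    have hpow0 : 0 < al ^ t := pow_pos ha0 t
    have hpow1 : al ^ t ≤ 1 := pow_le_one₀ ha0.le ha1.le
    have hden : 0 < 1 - al ^ (t + 1) := by
      have : al ^ (t + 1) < 1 := pow_lt_one₀ ha0.le ha1 (by simp)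
      linarith
    have hsum : al * (1 - al ^ t) + (1 - al) = 1 - al ^ (t + 1) := by ring
    have hz'U : al • z + (1 - al) • c ∈ I.U :=
      hU hz hc'.1 ha0.le (by linarith) (by ring)
    have hw1 : 0 ≤ al * (1 - al ^ t) / (1 - al ^ (t + 1)) :=
      div_nonneg (mul_nonneg ha0.le (by linarith)) hden.le
    have hw2 : 0 ≤ (1 - al) / (1 - al ^ (t + 1)) := div_nonneg (by linarith) hden.le
    have hw3 : al * (1 - al ^ t) / (1 - al ^ (t + 1)) + (1 - al) / (1 - al ^ (t + 1)) = 1 := by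
      rw [← add_div, hsum, div_self hden.ne']
    set p' := (al * (1 - al ^ t) / (1 - al ^ (t + 1))) • p + ((1 - al) / (1 - al ^ (t + 1))) • c
      with hp'
    have hp'U : p' ∈ I.U := hU hp hc'.1 hw1 hw2 hw3
    have hp'eq : (1 - al ^ (t + 1)) • p' = al • ((1 - al ^ t) • p) + (1 - al) • c := by
      rw [hp', smul_add, smul_smul, smul_smul, mul_div_cancel₀ _ hden.ne',
        mul_div_cancel₀ _ hden.ne', smul_smul]
    have htheta : al ^ (t + 1) * I.theta (t + 1) = 1 := by
      unfold theta; rw [← hal]; exact mul_inv_cancel₀ (pow_pos ha0 _).ne'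
    -- The new z, the weighted average p and A all follow the recursion new = α·old + (1 - α)·c. In
    -- z the starting point keeps the weight α^t; p leaves it out, so phi and omega are averaged
    -- over the prox outputs only.
    refine ⟨hc', al • z + (1 - al) • c, hz'U, p', hp'U,
      al * A + (1 - al) * (I.phi c + I.mu * I.omega c), ?_, ?_, ?_, ?_, ?_, ?_⟩
    · change al • z + (1 - al) • c = a + (1 - al) • (c - s.cur)
      rw [hhat]; module
    · rw [hp'eq, hz2]; rw [pow_succ]; module
    · have h4 : (1 - al) * al ^ (t + 1) * I.theta (t + 1) = 1 - al := by
        rw [mul_assoc, htheta, mul_one]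
      rw [hp'eq, hp1, smul_add, smul_smul _ (I.theta (t + 1)), h4, smul_smul]
      congr 2
      ring
    · dsimp only
      linear_combination al * hw + (1 - al) * htheta
    · have h5 := hphi.2 hp hc'.1 hw1 hw2 hw3
      have h6 := (hdgf.strongConvexOn.convexOn fun r => by dsimp; positivity).2 hp hc'.1 hw1 hw2 hw3
      rw [← hp'] at h5 h6
      simp only [smul_eq_mul] at h5 h6
      have h7 : I.phi p' + I.mu * I.omega p' ≤
          al * (1 - al ^ t) / (1 - al ^ (t + 1)) * (I.phi p + I.mu * I.omega p)
            + (1 - al) / (1 - al ^ (t + 1)) * (I.phi c + I.mu * I.omega c) := by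
        nlinarith [mul_le_mul_of_nonneg_left h6 hmu.le]
      have h8 := mul_le_mul_of_nonneg_left h7 hden.le
      have h9 : (1 - al ^ (t + 1)) *
          (al * (1 - al ^ t) / (1 - al ^ (t + 1)) * (I.phi p + I.mu * I.omega p)
            + (1 - al) / (1 - al ^ (t + 1)) * (I.phi c + I.mu * I.omega c))
          = al * ((1 - al ^ t) * (I.phi p + I.mu * I.omega p))
            + (1 - al) * (I.phi c + I.mu * I.omega c) := by
        field_simp
      rw [h9] at h8
      have h10 := mul_le_mul_of_nonneg_left hA ha0.le
      linarith
    · have hb1 := (hh a hhatU _ hz'U).2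
      have hb2 := (hh a hhatU z hz).1
      have hb3 := (hh a hhatU q hq).1
      have hg := hgrad a hhatU q hq c hc'.1
      have hd1 : al • z + (1 - al) • c - a = (1 - al) • (c - s.cur) := by rw [hhat]; module
      have hd2 : G a (al • z + (1 - al) • c - a) = al * G a (z - a) + (1 - al) * G a (c - a) := by
        rw [← smul_eq_mul, ← smul_eq_mul, ← map_smul, ← map_smul, ← map_add]
        congr 1; module
      have hnorm : ‖al • z + (1 - al) • c - a‖ ^ 2 = (1 - al) ^ 2 * ‖c - s.cur‖ ^ 2 := by
        rw [hd1, norm_smul, mul_pow, Real.norm_eq_abs, sq_abs]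
      rw [hd2, hnorm] at hb1
      have hbr := hdgf.half_sq_le_bregman hc'.1 hcur
      have hst := I.L_mul_one_sub_alpha_sq_le hmu hL
      rw [← hal] at hst
      have hst2 : I.L / 2 * ((1 - al) ^ 2 * ‖c - s.cur‖ ^ 2)
          ≤ al * I.mu * bregman I.omega c s.cur := by
        have e1 : I.L / 2 * ((1 - al) ^ 2 * ‖c - s.cur‖ ^ 2)
            = I.L * (1 - al) ^ 2 * (1 / 2 * ‖c - s.cur‖ ^ 2) := by ring
        rw [e1]
        exact mul_le_mul hst hbr (by positivity) (by positivity)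
      have i1 := I.one_sub_alpha_mul_add hmu hL
      have i2 := I.one_sub_alpha_mul_eta hmu hL
      rw [← hal] at i1 i2
      have h3' := mul_le_mul_of_nonneg_left h3 (sub_nonneg.2 ha1.le)
      have hb2' := mul_nonneg ha0.le hb2
      have hb3' := mul_nonneg (sub_nonneg.2 ha1.le) hb3
      have hg' := mul_le_mul_of_nonneg_left hg (sub_nonneg.2 ha1.le)
      have hV' := mul_le_mul_of_nonneg_left hV ha0.le
      have j1 : (1 - al) * (I.phi c + I.mu * I.omega c + xi c + I.eta * bregman I.omega c s.cur
            + (I.mu + I.eta) * bregman I.omega q c)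
          = (1 - al) * (I.phi c + I.mu * I.omega c + xi c)
            + al * I.mu * bregman I.omega c s.cur + I.mu * bregman I.omega q c := by
        linear_combination bregman I.omega c s.cur * i2 + bregman I.omega q c * i1
      have j2 : (1 - al) * (I.phi q + I.mu * I.omega q + xi q + I.eta * bregman I.omega q s.cur)
          = (1 - al) * (I.phi q + I.mu * I.omega q + xi q)
            + al * I.mu * bregman I.omega q s.cur := by
        linear_combination bregman I.omega q s.cur * i2
      rw [j1, j2] at h3'
      simp only [sub_apply, map_sub] at hg' hb1 hb2' hb3'
      dsimp only
      rw [pow_succ]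
      linarith

/-- Linear convergence of the inexact accelerated proximal gradient method. -/
theorem run_spec (I : APGInput V) {dom : Set V} {h : V → ℝ} {G : V → V →L[ℝ] ℝ}
    {sigma : ℝ} (hmu : 0 < I.mu) (hL : 0 < I.L) (hU : Convex ℝ I.U)
    (hdgf : IsDGF I.U dom I.omega) (hphi : ConvexOn ℝ I.U I.phi)
    (hbpp : HasBPP I.U dom I.omega I.phi) (hh : IsSmoothConvexOn I.U h G I.L)
    (grad : V → OracleProg E F (V →L[ℝ] ℝ))
    (hgrad : ∀ a ∈ I.U, ∀ b ∈ I.U, ∀ c ∈ I.U, ((grad a).result OX OY - G a) (b - c) ≤ sigma)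
    {u0 : V} (hu0 : u0 ∈ I.U ∩ interior dom) {k : ℕ} (hk : k ≠ 0) :
    (I.run grad u0 k).result OX OY ∈ I.U ∧ ∀ q ∈ I.U,
      (1 - I.alpha ^ k) *
        (h ((I.run grad u0 k).result OX OY) + I.phi ((I.run grad u0 k).result OX OY)
          + I.mu * I.omega ((I.run grad u0 k).result OX OY) - (h q + I.phi q + I.mu * I.omega q)) ≤
      I.alpha ^ k * (I.mu * bregman I.omega q u0
        + I.L / 2 * ‖u0 - (I.run grad u0 k).result OX OY‖ ^ 2) + (1 - I.alpha ^ k) * sigma := by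
  have ha0 := I.alpha_pos hmu hL
  have ha1 := I.alpha_lt_one hmu hL
  have hpow0 : 0 < I.alpha ^ k := pow_pos ha0 k
  have hpow1 : I.alpha ^ k < 1 := pow_lt_one₀ ha0.le ha1 hk
  have key : ∀ q ∈ I.U, (I.run grad u0 k).result OX OY ∈ I.U ∧
      (1 - I.alpha ^ k) *
        (h ((I.run grad u0 k).result OX OY) + I.phi ((I.run grad u0 k).result OX OY)
          + I.mu * I.omega ((I.run grad u0 k).result OX OY) - (h q + I.phi q + I.mu * I.omega q)) ≤
      I.alpha ^ k * (I.mu * bregman I.omega q u0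
        + I.L / 2 * ‖u0 - (I.run grad u0 k).result OX OY‖ ^ 2) + (1 - I.alpha ^ k) * sigma := by
    intro q hq
    obtain ⟨hcur, z, hz, p, hp, A, -, hz2, hp1, hw, hA, hV⟩ :=
      I.iterate_lyapunov OX OY hmu hL hU hdgf hphi hbpp hh grad hgrad hu0 hq k
    have hout : (I.run grad u0 k).result OX OY = p := by
      rw [run, OracleProg.result_bind]
      set s := (I.iterate grad u0 k).result OX OY
      change s.weight⁻¹ • s.wsum = p
      -- The factor (1 - α)α^k normalizes both the weighted sum and the total weight, so their
      -- quotient is p. This needs k ≠ 0: with no step the weight is 0.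
      have hne : (1 - I.alpha) * I.alpha ^ k ≠ 0 :=
        (mul_pos (by linarith) hpow0).ne'
      have hwne : s.weight ≠ 0 := by
        intro h0; rw [h0, mul_zero] at hw; linarith
      rw [← hw, mul_smul] at hp1
      have := smul_right_injective V hne hp1
      rw [← this, smul_smul, inv_mul_cancel₀ hwne, one_smul]
    rw [hout]
    refine ⟨hp, ?_⟩
    -- The Lyapunov function contains h(z), not h(p). Since z - p = α^k(u0 - p), the tangent bound
    -- at z and α^k times the smoothness bound at u0 contain the same gradient term, which cancels;
    -- what remains is α^k (L/2) ‖u0 - p‖².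
    have c1 := (hh p hp z hz).1
    have c2 := (hh p hp u0 hu0.1).2
    have hzp : z - p = I.alpha ^ k • (u0 - p) := by rw [hz2]; module
    rw [hzp, map_smul, smul_eq_mul] at c1
    have c3 := mul_le_mul_of_nonneg_left c2 hpow0.le
    have c4 := mul_nonneg hmu.le (hdgf.bregman_nonneg hq hcur)
    linarith
  exact ⟨(key u0 hu0.1).1, fun q hq => (key q hq).2⟩

end APGInput

/-! ### Strongly convex minimization -/

section Minimization

variable {V : Type*} [NormedAddCommGroup V] [NormedSpace ℝ V]

theorem ConvexOn.add_const_mul_strongConvexOn {U : Set V} {f g : V → ℝ} {c : ℝ}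
    (hf : ConvexOn ℝ U f) (hg : StrongConvexOn U 1 g) (hc : 0 ≤ c) :
    StrongConvexOn U c (fun a => f a + c * g a) := by
  refine ⟨hf.1, fun a ha b hb s t hs ht hst => ?_⟩
  have h1 := hf.2 ha hb hs ht hst
  have h2 := mul_le_mul_of_nonneg_left (hg.2 ha hb hs ht hst) hc
  simp only [smul_eq_mul] at h1 h2 ⊢
  linarith

omit [NormedSpace ℝ V] in
/-- A continuous function on a closed set with a quadratic minorant has a minimizer. -/
theorem exists_minimizer_of_quadratic_minorant [ProperSpace V] {U : Set V} {f : V → ℝ}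
    {m K : ℝ} (hU : IsClosed U) (hf : ContinuousOn f U) (hm : 0 < m) {a : V} (ha : a ∈ U)
    (h : ∀ b ∈ U, m / 2 * ‖b - a‖ ^ 2 - K * ‖b - a‖ ≤ f b - f a) :
    ∃ p, p ∈ U ∧ ∀ b ∈ U, f p ≤ f b := by
  obtain ⟨p, hp, hmin⟩ := hf.exists_isMinOn' hU ha (by
    -- Outside the ball of radius 2K/m the quadratic minorant is nonnegative, so f is at least f a
    -- there.
    refine mem_inf_of_inter (isCompact_closedBall a (2 * K / m)).compl_mem_cocompact
      (mem_principal_self U) ?_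
    rintro b ⟨hb, hbU⟩
    have h1 : 2 * K / m < ‖b - a‖ := by
      simpa [dist_eq_norm] using hb
    rw [div_lt_iff₀ hm] at h1
    have h2 := h b hbU
    have h3 : 0 ≤ ‖b - a‖ * (m / 2 * ‖b - a‖ - K) :=
      mul_nonneg (norm_nonneg _) (by linarith)
    change f a ≤ f b
    nlinarith)
  exact ⟨p, hp, fun b hb => hmin hb⟩

/-- Minimizers of two strongly convex functions are close if the increments of the functions are. -/
theorem StrongConvexOn.mul_norm_minimizer_sub_le {U : Set V} {m K : ℝ} {f g : V → ℝ}
    (hf : StrongConvexOn U m f) (hg : StrongConvexOn U m g) {a b : V} (ha : a ∈ U) (hb : b ∈ U)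
    (hfa : ∀ c ∈ U, f a ≤ f c) (hgb : ∀ c ∈ U, g b ≤ g c)
    (hK : (f b - g b) - (f a - g a) ≤ K * ‖b - a‖) (hK0 : 0 ≤ K) : m * ‖b - a‖ ≤ K := by
  have h1 := hf.quadratic_growth ha hfa hb
  have h2 := hg.quadratic_growth hb hgb ha
  rw [norm_sub_rev a b] at h2
  rcases (norm_nonneg (b - a)).eq_or_lt with h0 | h0
  · rw [← h0, mul_zero]; exact hK0
  · refine le_of_mul_le_mul_right ?_ h0
    nlinarith

/-- Near a the function is squeezed between its tangent and a paraboloid. This supplies the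
continuity of π that the existence of a dual maximizer needs. -/
theorem IsSmoothConvexOn.continuousOn {U : Set V} {h : V → ℝ} {G : V → V →L[ℝ] ℝ} {L : ℝ}
    (hs : IsSmoothConvexOn U h G L) : ContinuousOn h U := by
  intro a ha
  have h1 : Tendsto (fun b => h a + G a (b - a)) (𝓝[U] a) (𝓝 (h a)) := by
    have : Continuous fun b => h a + G a (b - a) := by fun_prop
    simpa using (this.tendsto a).mono_left nhdsWithin_le_nhds
  have h2 : Tendsto (fun b => h a + G a (b - a) + L / 2 * ‖b - a‖ ^ 2) (𝓝[U] a) (𝓝 (h a)) := by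
    have : Continuous fun b => h a + G a (b - a) + L / 2 * ‖b - a‖ ^ 2 := by fun_prop
    simpa using (this.tendsto a).mono_left nhdsWithin_le_nhds
  refine tendsto_of_tendsto_of_tendsto_of_le_of_le' h1 h2 ?_ ?_
  · filter_upwards [self_mem_nhdsWithin] with b hb
    linarith [(hs a ha b hb).1]
  · filter_upwards [self_mem_nhdsWithin] with b hb
    linarith [(hs a ha b hb).2]

/-- A convex function with a Lipschitz continuous subgradient map is smooth. -/
theorem IsSmoothConvexOn.of_lipschitz {U : Set V} {h : V → ℝ} {G : V → V →L[ℝ] ℝ} {L : ℝ}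
    (hU : Convex ℝ U) (hG : ∀ a ∈ U, ∀ b ∈ U, 0 ≤ h b - h a - G a (b - a))
    (hL : ∀ a ∈ U, ∀ b ∈ U, ‖G a - G b‖ ≤ L * ‖a - b‖) : IsSmoothConvexOn U h G L := by
  intro a ha b hb
  refine ⟨hG a ha b hb, ?_⟩
  -- Differentiability of h is not available, so the segment is cut into N + 1 pieces instead of
  -- integrating. On each piece the subgradient inequality at the far end is used; the errors sum to
  -- a Riemann sum with excess 1/(N + 1), which vanishes in the limit.
  have key : ∀ N : ℕ, h b - h a - G a (b - a)
      ≤ L / 2 * ‖b - a‖ ^ 2 * (1 + 1 / ((N : ℝ) + 1)) := by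
    intro N
    have hN : (0 : ℝ) < (N : ℝ) + 1 := by positivity
    set d : ℝ := 1 / ((N : ℝ) + 1) with hd
    have hd0 : 0 < d := by positivity
    have hdN : ((N : ℝ) + 1) * d = 1 := by rw [hd]; field_simp
    have step : ∀ i : ℕ, i ≤ N + 1 →
        h (a + ((i : ℝ) * d) • (b - a)) - h a ≤ (i : ℝ) * d * G a (b - a)
          + L / 2 * ‖b - a‖ ^ 2 * (d ^ 2 * (i * (i + 1))) := by
      intro i
      induction i with
      | zero => simp
      | succ i ih =>
        intro hi
        have ih' := ih (by omega)
        have hi' : ((i : ℝ) + 1) ≤ (N : ℝ) + 1 := by exact_mod_cast hi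
        have hmem : ∀ s : ℝ, 0 ≤ s → s ≤ (N : ℝ) + 1 → a + (s * d) • (b - a) ∈ U := by
          intro s hs0 hs1
          refine hU.add_smul_sub_mem_of_le hb ha (by positivity) ?_
          rw [← hdN]; gcongr
        have hm0 := hmem i (by positivity) (by linarith)
        have hm1 := hmem (i + 1) (by positivity) hi'
        push_cast
        set p := a + ((i : ℝ) * d) • (b - a) with hp
        set q := a + (((i : ℝ) + 1) * d) • (b - a) with hq
        have h1 := hG q hm1 p hm0
        have hpq : p - q = (-d) • (b - a) := by rw [hp, hq]; module
        rw [hpq, map_smul, smul_eq_mul] at h1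
        have h2 : (G q - G a) (b - a) ≤ L * (((i : ℝ) + 1) * d) * ‖b - a‖ ^ 2 := by
          have h3 := hL q hm1 a ha
          have hqa : q - a = (((i : ℝ) + 1) * d) • (b - a) := by rw [hq]; module
          rw [hqa, norm_smul, Real.norm_eq_abs, abs_of_pos (by positivity)] at h3
          calc (G q - G a) (b - a) ≤ ‖(G q - G a) (b - a)‖ := Real.le_norm_self _
            _ ≤ ‖G q - G a‖ * ‖b - a‖ := (G q - G a).le_opNorm _
            _ ≤ _ := by nlinarith [norm_nonneg (b - a)]
        rw [sub_apply] at h2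
        have h4 := mul_le_mul_of_nonneg_left h2 hd0.le
        nlinarith
    have h5 := step (N + 1) le_rfl
    push_cast at h5
    rw [hdN, one_smul, add_sub_cancel] at h5
    have h6 : d ^ 2 * (((N : ℝ) + 1) * ((N : ℝ) + 1 + 1)) = 1 + d := by
      have : d ^ 2 * (((N : ℝ) + 1) * ((N : ℝ) + 1 + 1))
          = ((N : ℝ) + 1) * d * (((N : ℝ) + 1) * d + d) := by ring
      rw [this, hdN]; ring
    rw [h6] at h5
    linarith
  have hlim : Tendsto (fun N : ℕ => L / 2 * ‖b - a‖ ^ 2 * (1 + 1 / ((N : ℝ) + 1))) atTop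
      (𝓝 (L / 2 * ‖b - a‖ ^ 2)) := by
    have := (tendsto_one_div_add_atTop_nhds_zero_nat (𝕜 := ℝ)).const_add 1
    simpa using this.const_mul (L / 2 * ‖b - a‖ ^ 2)
  exact ge_of_tendsto' hlim key

end Minimization

/-! ### The saddle-point problem -/

namespace SaddleData

variable {E : Type u} {F : Type v} [NormedAddCommGroup E] [NormedSpace ℝ E]
  [NormedAddCommGroup F] [NormedSpace ℝ F]
  {D : SaddleData E F} {Psi : E → F → ℝ}

/-- The minimizer of `ψᴾ(·, y)`. -/
noncomputable def xstar (D : SaddleData E F) (Psi : E → F → ℝ) (y : F) : E :=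
  argminOn D.X (fun x => D.psiP Psi x y)

/-- The maximizer of `d_ρ`. -/
noncomputable def ystar (D : SaddleData E F) (Psi : E → F → ℝ) (rho : ℝ) : F :=
  argminOn D.Y (fun y => -D.dualFn Psi rho y)

/-- The maximizer of `ψᴰ_ρ(x, ·)`. -/
noncomputable def ybest (D : SaddleData E F) (Psi : E → F → ℝ) (rho : ℝ) (x : E) : F :=
  argminOn D.Y (fun y => -D.psiD Psi rho x y)

namespace Standing

theorem isSmoothConvexOn_Psi (hS : D.Standing Psi) {y : F} (hy : y ∈ D.Y) :
    IsSmoothConvexOn D.X (fun x => Psi x y) (fun x => gradX Psi x y) D.Lxx :=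
  fun a ha b hb => ⟨hS.Psi_convex a ha b hb y hy, hS.Psi_smoothXX a ha b hb y hy⟩

theorem mem_interior (hS : D.Standing Psi) {x : E} (hx : x ∈ D.X) :
    x ∈ D.X ∩ interior D.domX := ⟨hx, hS.X_subset hx⟩

theorem Lxx_pos (hS : D.Standing Psi) : 0 < D.Lxx := hS.mu_pos.trans_le hS.mu_le

theorem Lpi_pos (hS : D.Standing Psi) : 0 < D.Lpi := by
  have := hS.mu_pos
  have := hS.Lxy_pos
  have := hS.Lyy_nonneg
  unfold Lpi
  positivity

theorem psiP_strongConvexOn (hS : D.Standing Psi) {y : F} (hy : y ∈ D.Y) :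
    StrongConvexOn D.X D.mu (fun x => D.psiP Psi x y) :=
  (((hS.isSmoothConvexOn_Psi hy).convexOn hS.X_convex).add
    hS.r_convex).add_const_mul_strongConvexOn hS.omegaX_dgf.strongConvexOn hS.mu_pos.le

/-- X may be unbounded, so existence of x*(y) needs coercivity: the quadratic term comes from μω_X,
while Ψ and r drop at most linearly. -/
theorem psiP_minorant (hS : D.Standing Psi) {y : F} (hy : y ∈ D.Y) {a b : E} (ha : a ∈ D.X)
    (hb : b ∈ D.X) : D.mu / 2 * ‖b - a‖ ^ 2
      - (‖gradX Psi a y‖ + D.Mr + D.mu * ‖fderiv ℝ D.omegaX a‖) * ‖b - a‖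
      ≤ D.psiP Psi b y - D.psiP Psi a y := by
  have h1 := hS.Psi_convex a ha b hb y hy
  have h2 := hS.r_lipschitz b hb a ha
  have h3 := hS.omegaX_dgf.half_sq_le_bregman hb (hS.mem_interior ha)
  have h4 := (gradX Psi a y).le_opNorm (b - a)
  have h5 := (fderiv ℝ D.omegaX a).le_opNorm (b - a)
  rw [Real.norm_eq_abs] at h4 h5
  have h4' := (abs_le.1 h4).1
  have h5' := (abs_le.1 h5).1
  have h2' := (abs_le.1 h2).1
  unfold bregman at h3
  have h6 := mul_le_mul_of_nonneg_left h3 hS.mu_pos.le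
  have h7 := mul_le_mul_of_nonneg_left h5' hS.mu_pos.le
  unfold psiP
  linarith

theorem r_continuousOn (hS : D.Standing Psi) : ContinuousOn D.r D.X := by
  refine (LipschitzOnWith.of_dist_le_mul (K := ⟨D.Mr, hS.Mr_nonneg⟩) ?_).continuousOn
  intro x hx x' hx'
  rw [dist_eq_norm, dist_eq_norm]
  exact hS.r_lipschitz x hx x' hx'

theorem g_continuousOn (hS : D.Standing Psi) : ContinuousOn D.g D.Y := by
  refine (LipschitzOnWith.of_dist_le_mul (K := ⟨D.Mg, hS.Mg_nonneg⟩) ?_).continuousOn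
  intro x hx x' hx'
  rw [dist_eq_norm, dist_eq_norm]
  exact hS.g_lipschitz x hx x' hx'

theorem Psi_continuousOn_left (hS : D.Standing Psi) {y : F} (hy : y ∈ D.Y) :
    ContinuousOn (fun x => Psi x y) D.X :=
  hS.Psi_continuous.comp (f := fun x : E => (x, y)) (by fun_prop) (fun _ hx => ⟨hx, hy⟩)

theorem Psi_continuousOn_right (hS : D.Standing Psi) {x : E} (hx : x ∈ D.X) :
    ContinuousOn (fun y => Psi x y) D.Y :=
  hS.Psi_continuous.comp (f := fun y : F => (x, y)) (by fun_prop) (fun _ hy => ⟨hx, hy⟩)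

/-! ### The inner minimization: the map x* and smoothness of π. -/

section Primal

variable [FiniteDimensional ℝ E]

theorem xstar_spec (hS : D.Standing Psi) {y : F} (hy : y ∈ D.Y) :
    D.xstar Psi y ∈ D.X ∧ ∀ x ∈ D.X, D.psiP Psi (D.xstar Psi y) y ≤ D.psiP Psi x y := by
  have : ProperSpace E := FiniteDimensional.proper ℝ E
  obtain ⟨a, ha⟩ := hS.X_nonempty
  refine argminOn_spec (f := fun x => D.psiP Psi x y)
    (exists_minimizer_of_quadratic_minorant hS.X_closed ?_ hS.mu_pos ha
      fun b hb => hS.psiP_minorant hy ha hb)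
  exact ((hS.Psi_continuousOn_left hy).add hS.r_continuousOn).add
    (hS.omegaX_dgf.continuousOn.const_smul D.mu)

theorem xstar_mem (hS : D.Standing Psi) {y : F} (hy : y ∈ D.Y) : D.xstar Psi y ∈ D.X :=
  (hS.xstar_spec hy).1

theorem piFn_eq (hS : D.Standing Psi) {y : F} (hy : y ∈ D.Y) :
    D.piFn Psi y = D.psiP Psi (D.xstar Psi y) y := by
  refine IsLeast.csInf_eq ⟨mem_image_of_mem _ (hS.xstar_mem hy), ?_⟩
  rintro _ ⟨x, hx, rfl⟩
  exact (hS.xstar_spec hy).2 x hx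

theorem piFn_le (hS : D.Standing Psi) {x : E} (hx : x ∈ D.X) {y : F} (hy : y ∈ D.Y) :
    D.piFn Psi y ≤ D.psiP Psi x y := by
  rw [hS.piFn_eq hy]; exact (hS.xstar_spec hy).2 x hx

theorem psiP_growth (hS : D.Standing Psi) {x : E} (hx : x ∈ D.X) {y : F} (hy : y ∈ D.Y) :
    D.mu / 2 * ‖x - D.xstar Psi y‖ ^ 2 ≤ D.psiP Psi x y - D.piFn Psi y := by
  rw [hS.piFn_eq hy]
  exact (hS.psiP_strongConvexOn hy).quadratic_growth (hS.xstar_mem hy) (hS.xstar_spec hy).2 hx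

omit [FiniteDimensional ℝ E] in
-- The function Ψ(·, y) - Ψ(·, y') has gradient at most L_xy‖y - y'‖ on X, so the mean value
-- inequality applies. All coupling between the two variables is estimated through this mixed
-- difference.
theorem cross_le (hS : D.Standing Psi) {x x' : E} (hx : x ∈ D.X) (hx' : x' ∈ D.X) {y y' : F}
    (hy : y ∈ D.Y) (hy' : y' ∈ D.Y) :
    (Psi x' y - Psi x' y') - (Psi x y - Psi x y') ≤ D.Lxy * ‖y - y'‖ * ‖x' - x‖ := by
  have h := hS.X_convex.norm_image_sub_le_of_norm_fderiv_le (𝕜 := ℝ)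
    (f := fun x => Psi x y - Psi x y') (C := D.Lxy * ‖y - y'‖)
    (fun a ha => (hS.Psi_diffX a ha y hy).sub (hS.Psi_diffX a ha y' hy'))
    (fun a ha => by
      have := fderiv_fun_sub (hS.Psi_diffX a ha y hy) (hS.Psi_diffX a ha y' hy')
      rw [this]
      exact hS.Psi_smoothXY a ha y hy y' hy') hx hx'
  exact (Real.le_norm_self _).trans h

theorem xstar_lipschitz (hS : D.Standing Psi) {y y' : F} (hy : y ∈ D.Y) (hy' : y' ∈ D.Y) :
    ‖D.xstar Psi y - D.xstar Psi y'‖ ≤ D.Lxy / D.mu * ‖y - y'‖ := by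
  have hx := hS.xstar_mem hy
  have hx' := hS.xstar_mem hy'
  have hc := hS.cross_le hx' hx hy' hy
  have h := (hS.psiP_strongConvexOn hy').mul_norm_minimizer_sub_le (hS.psiP_strongConvexOn hy)
    hx' hx (hS.xstar_spec hy').2 (hS.xstar_spec hy).2 (K := D.Lxy * ‖y' - y‖)
    (by unfold psiP; linarith) (mul_nonneg hS.Lxy_pos.le (norm_nonneg _))
  rw [norm_sub_rev y' y] at h
  rw [div_mul_eq_mul_div, le_div_iff₀ hS.mu_pos]
  linarith

omit [FiniteDimensional ℝ E] in
theorem Psi_le_linear (hS : D.Standing Psi) {x : E} (hx : x ∈ D.X) {y y' : F} (hy : y ∈ D.Y)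
    (hy' : y' ∈ D.Y) : Psi x y' ≤ Psi x y + gradY Psi x y (y' - y) := by
  have h := (hS.Psi_diffY x hx y hy).hasFDerivAt.hasDerivAt_line (y' - y)
  have := h.le_of_forall_linear_le (c := Psi x y' - Psi x y) ?_
  · unfold gradY; linarith
  · intro t ht ht1
    have h4 := (hS.Psi_concave x hx).2 hy' hy ht.le (sub_nonneg.2 ht1) (by ring)
    rw [← add_smul_sub_eq y' y] at h4
    simp only [smul_eq_mul] at h4
    simp only [zero_smul, add_zero]
    linarith

/-- `-π` is convex and `L_π`-smooth on `Y`. -/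
theorem isSmoothConvexOn_neg_piFn (hS : D.Standing Psi) :
    IsSmoothConvexOn D.Y (fun y => -D.piFn Psi y) (fun y => -gradY Psi (D.xstar Psi y) y)
      D.Lpi := by
  refine IsSmoothConvexOn.of_lipschitz hS.Y_convex ?_ ?_
  · intro y hy y' hy'
    have hx := hS.xstar_mem hy
    -- Envelope argument: freezing x*(y) bounds π(y') from above, and concavity of Ψ in y linearizes
    -- that bound.
    have h1 := hS.Psi_le_linear hx hy hy'
    have h2 := hS.piFn_le hx hy'
    rw [hS.piFn_eq hy]
    simp only [neg_apply]
    unfold psiP at *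
    linarith
  · intro y hy y' hy'
    have hx := hS.xstar_mem hy
    have hx' := hS.xstar_mem hy'
    have h1 := hS.Psi_smoothYX _ hx _ hx' y hy
    have h2 := hS.Psi_smoothYY _ hx' y hy y' hy'
    have h3 := hS.xstar_lipschitz hy hy'
    -- Changing x at fixed y costs L_xy · L_xy/μ, then changing y costs L_yy; together they give
    -- L_π.
    have h4 : -gradY Psi (D.xstar Psi y) y - -gradY Psi (D.xstar Psi y') y'
        = -((gradY Psi (D.xstar Psi y) y - gradY Psi (D.xstar Psi y') y)
          + (gradY Psi (D.xstar Psi y') y - gradY Psi (D.xstar Psi y') y')) := by abel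
    rw [h4, norm_neg]
    refine (norm_add_le _ _).trans ?_
    have h5 := mul_le_mul_of_nonneg_left h3 hS.Lxy_pos.le
    have h6 : D.Lpi * ‖y - y'‖
        = D.Lxy * (D.Lxy / D.mu * ‖y - y'‖) + D.Lyy * ‖y - y'‖ := by unfold Lpi; ring
    rw [h6]
    linarith

end Primal

/-! ### The smoothed dual problem, its saddle point, and part (a). -/

section Dual

theorem isCompact_Y [FiniteDimensional ℝ F] (hS : D.Standing Psi) : IsCompact D.Y := by
  have : ProperSpace F := FiniteDimensional.proper ℝ F
  exact Metric.isCompact_of_isClosed_isBounded hS.Y_closed hS.Y_bounded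

theorem abs_omegaY_le [FiniteDimensional ℝ F] (hS : D.Standing Psi) {y : F} (hy : y ∈ D.Y) :
    |D.omegaY y| ≤ D.Omega :=
  le_csSup (hS.isCompact_Y.image_of_continuousOn hS.omegaY_dgf.continuousOn.abs).bddAbove
    (mem_image_of_mem _ hy)

theorem psiD_strongConvexOn (hS : D.Standing Psi) {rho : ℝ} (hrho : 0 ≤ rho) {x : E}
    (hx : x ∈ D.X) : StrongConvexOn D.Y rho (fun y => -D.psiD Psi rho x y) := by
  have h := ((hS.Psi_concave x hx).neg.add hS.g_convex).add_const_mul_strongConvexOn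
    hS.omegaY_dgf.strongConvexOn hrho
  convert h using 2 with y
  simp only [psiD, Pi.add_apply, Pi.neg_apply]
  ring

theorem ybest_spec [FiniteDimensional ℝ F] (hS : D.Standing Psi) (rho : ℝ) {x : E}
    (hx : x ∈ D.X) : D.ybest Psi rho x ∈ D.Y ∧
      ∀ y ∈ D.Y, D.psiD Psi rho x y ≤ D.psiD Psi rho x (D.ybest Psi rho x) := by
  have hc : ContinuousOn (fun y => -D.psiD Psi rho x y) D.Y :=
    (((hS.Psi_continuousOn_right hx).sub hS.g_continuousOn).sub
      (hS.omegaY_dgf.continuousOn.const_smul rho)).neg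
  obtain ⟨p, hp, hmin⟩ := hS.isCompact_Y.exists_isMinOn hS.Y_nonempty hc
  have h := argminOn_spec (U := D.Y) (f := fun y => -D.psiD Psi rho x y)
    ⟨p, hp, fun b hb => hmin hb⟩
  exact ⟨h.1, fun y hy => neg_le_neg_iff.1 (h.2 y hy)⟩

theorem fbar_eq [FiniteDimensional ℝ F] (hS : D.Standing Psi) (rho : ℝ) {x : E}
    (hx : x ∈ D.X) : D.fbar Psi rho x = D.psiD Psi rho x (D.ybest Psi rho x) := by
  refine IsGreatest.csSup_eq ⟨mem_image_of_mem _ (hS.ybest_spec rho hx).1, ?_⟩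
  rintro _ ⟨y, hy, rfl⟩
  exact (hS.ybest_spec rho hx).2 y hy

variable [FiniteDimensional ℝ E]

theorem dualFn_strongConvexOn (hS : D.Standing Psi) {rho : ℝ} (hrho : 0 ≤ rho) :
    StrongConvexOn D.Y rho (fun y => -D.dualFn Psi rho y) := by
  have h := ((hS.isSmoothConvexOn_neg_piFn.convexOn hS.Y_convex).add
    hS.g_convex).add_const_mul_strongConvexOn hS.omegaY_dgf.strongConvexOn hrho
  convert h using 2 with y
  simp only [dualFn, Pi.add_apply]
  ring

variable [FiniteDimensional ℝ F]

theorem ystar_spec (hS : D.Standing Psi) (rho : ℝ) : D.ystar Psi rho ∈ D.Y ∧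
    ∀ y ∈ D.Y, D.dualFn Psi rho y ≤ D.dualFn Psi rho (D.ystar Psi rho) := by
  have hc : ContinuousOn (fun y => -D.dualFn Psi rho y) D.Y := by
    have h := (hS.isSmoothConvexOn_neg_piFn.continuousOn.add hS.g_continuousOn).add
      (hS.omegaY_dgf.continuousOn.const_smul rho)
    refine h.congr fun y _ => ?_
    simp only [dualFn, Pi.add_apply, Pi.smul_apply, smul_eq_mul]
    ring
  obtain ⟨p, hp, hmin⟩ := hS.isCompact_Y.exists_isMinOn hS.Y_nonempty hc
  have h := argminOn_spec (U := D.Y) (f := fun y => -D.dualFn Psi rho y)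
    ⟨p, hp, fun b hb => hmin hb⟩
  exact ⟨h.1, fun y hy => neg_le_neg_iff.1 (h.2 y hy)⟩

theorem dualOpt_eq (hS : D.Standing Psi) (rho : ℝ) :
    D.dualOpt Psi rho = D.dualFn Psi rho (D.ystar Psi rho) := by
  refine IsGreatest.csSup_eq ⟨mem_image_of_mem _ (hS.ystar_spec rho).1, ?_⟩
  rintro _ ⟨y, hy, rfl⟩
  exact (hS.ystar_spec rho).2 y hy

theorem dualFn_growth (hS : D.Standing Psi) {rho : ℝ} (hrho : 0 ≤ rho) {y : F} (hy : y ∈ D.Y) :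
    rho / 2 * ‖y - D.ystar Psi rho‖ ^ 2 ≤ D.dualOpt Psi rho - D.dualFn Psi rho y := by
  have h := (hS.dualFn_strongConvexOn hrho).quadratic_growth (hS.ystar_spec rho).1
    (fun c hc => neg_le_neg ((hS.ystar_spec rho).2 c hc)) hy
  rw [hS.dualOpt_eq]
  linarith

/-- `(x*(y*), y*)` is a saddle point: `y*` maximizes `ψᴰ_ρ(x*(y*), ·)`. -/
theorem psiD_le_of_saddle (hS : D.Standing Psi) {rho : ℝ} (hrho : 0 ≤ rho) {y : F}
    (hy : y ∈ D.Y) :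
    D.psiD Psi rho (D.xstar Psi (D.ystar Psi rho)) y
      ≤ D.psiD Psi rho (D.xstar Psi (D.ystar Psi rho)) (D.ystar Psi rho) := by
  obtain ⟨hys, hmax⟩ := hS.ystar_spec rho
  set ys := D.ystar Psi rho
  have hxs := hS.xstar_mem hys
  set xs := D.xstar Psi ys with hxsdef
  have h1 := hS.Psi_le_linear hxs hys hy
  have hq : HasDerivAt (fun t : ℝ => t * gradY Psi xs ys (y - ys))
      (gradY Psi xs ys (y - ys)) 0 := by
    simpa using (hasDerivAt_id (0 : ℝ)).mul_const (gradY Psi xs ys (y - ys))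
  have h2 : HasDerivAt (fun t : ℝ => t ^ 2 * (D.Lpi / 2 * ‖y - ys‖ ^ 2)) 0 0 := by
    simpa using ((hasDerivAt_id (0 : ℝ)).pow 2).mul_const (D.Lpi / 2 * ‖y - ys‖ ^ 2)
  have h3 : gradY Psi xs ys (y - ys)
      ≤ (D.g y + rho * D.omegaY y) - (D.g ys + rho * D.omegaY ys) := by
    -- Maximality of ys along the segment gives the first-order condition: smoothness replaces π by
    -- its linearization up to a term in t², which has zero derivative at t = 0.
    have := (h2.sub hq).le_of_forall_linear_le
      (c := -((D.g y + rho * D.omegaY y) - (D.g ys + rho * D.omegaY ys))) ?_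
    · linarith
    · intro t ht ht1
      have hm := hS.Y_convex.add_smul_sub_mem_of_le hy hys ht.le ht1
      have h4 := (hS.isSmoothConvexOn_neg_piFn ys hys _ hm).2
      have h5 := hmax _ hm
      have h6 := hS.g_convex.2 hy hys ht.le (sub_nonneg.2 ht1) (by ring)
      have h7 := (hS.omegaY_dgf.strongConvexOn.convexOn fun r => by dsimp; positivity).2 hy hys
        ht.le (sub_nonneg.2 ht1) (by ring)
      rw [← add_smul_sub_eq] at h6 h7
      simp only [smul_eq_mul] at h6 h7
      rw [add_sub_cancel_left, norm_smul, mul_pow, Real.norm_eq_abs, sq_abs, map_smul,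
        neg_apply, smul_eq_mul, ← hxsdef] at h4
      unfold dualFn at h5
      have h8 := mul_le_mul_of_nonneg_left h7 hrho
      simp only [Pi.sub_apply]
      linarith
  unfold psiD
  linarith

theorem ybest_sub_ystar_le (hS : D.Standing Psi) {rho : ℝ} (hrho : 0 < rho) {x : E}
    (hx : x ∈ D.X) : ‖D.ybest Psi rho x - D.ystar Psi rho‖
      ≤ D.Lxy / rho * ‖x - D.xstar Psi (D.ystar Psi rho)‖ := by
  have hys := (hS.ystar_spec rho).1
  have hxs := hS.xstar_mem hys
  obtain ⟨hyb, hmax⟩ := hS.ybest_spec rho hx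
  set xs := D.xstar Psi (D.ystar Psi rho) with hxsdef
  have hc := hS.cross_le hxs hx hyb hys
  have h := (hS.psiD_strongConvexOn hrho.le hxs).mul_norm_minimizer_sub_le
    (hS.psiD_strongConvexOn hrho.le hx) hys hyb
    (fun c hc => neg_le_neg (hS.psiD_le_of_saddle hrho.le hc))
    (fun c hc => neg_le_neg (hmax c hc)) (K := D.Lxy * ‖x - xs‖)
    (by unfold psiD; linarith) (mul_nonneg hS.Lxy_pos.le (norm_nonneg _))
  rw [div_mul_eq_mul_div, le_div_iff₀ hrho]
  linarith

theorem dualOpt_le_primalOpt (hS : D.Standing Psi) (rho : ℝ) :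
    D.dualOpt Psi rho ≤ D.primalOpt Psi rho := by
  refine le_csInf (hS.X_nonempty.image _) ?_
  rintro _ ⟨x, hx, rfl⟩
  have hys := (hS.ystar_spec rho).1
  have h1 := (hS.ybest_spec rho hx).2 _ hys
  have h2 := hS.piFn_le hx hys
  rw [hS.dualOpt_eq, primalFn, hS.fbar_eq rho hx]
  unfold dualFn psiD psiP at *
  linarith

/-- The primal error of an approximate solution. -/
theorem primalFn_sub_dualOpt_le (hS : D.Standing Psi) {rho : ℝ} (hrho : 0 < rho) {x : E}
    (hx : x ∈ D.X) {y : F} (hy : y ∈ D.Y) :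
    D.primalFn Psi rho x - D.dualOpt Psi rho ≤ (D.psiP Psi x y - D.piFn Psi y)
      + D.Lxy * (D.Lxy / rho * ‖x - D.xstar Psi (D.ystar Psi rho)‖ + ‖y - D.ystar Psi rho‖)
        * ‖x - D.xstar Psi (D.ystar Psi rho)‖ := by
  have hys := (hS.ystar_spec rho).1
  have hxs := hS.xstar_mem hys
  obtain ⟨hyb, hmax⟩ := hS.ybest_spec rho hx
  have h1 := hS.ybest_sub_ystar_le hrho hx
  have h2 := hS.psiD_le_of_saddle hrho.le hyb
  have h3 := hS.piFn_le hxs hy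
  have h4 := hS.piFn_eq hys
  -- The increment of Ψ from xs to x is moved from the best response yb to y, where it is controlled
  -- by ψᴾ(x, y) - π(y); the transfer costs a mixed difference. At xs the saddle property replaces
  -- yb by ys.
  have hc := hS.cross_le hxs hx hyb hy
  rw [hS.dualOpt_eq, primalFn, hS.fbar_eq rho hx]
  set ys := D.ystar Psi rho
  set xs := D.xstar Psi ys
  set yb := D.ybest Psi rho x
  have h5 : ‖yb - y‖ ≤ D.Lxy / rho * ‖x - xs‖ + ‖y - ys‖ := by
    have : yb - y = (yb - ys) - (y - ys) := by abel
    rw [this]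
    exact (norm_sub_le _ _).trans (by linarith)
  have h6 : D.Lxy * ‖yb - y‖ * ‖x - xs‖
      ≤ D.Lxy * (D.Lxy / rho * ‖x - xs‖ + ‖y - ys‖) * ‖x - xs‖ := by
    have := hS.Lxy_pos
    gcongr
  unfold dualFn psiD psiP at *
  linarith

omit [FiniteDimensional ℝ E] [FiniteDimensional ℝ F] in
theorem rho_pos (hS : D.Standing Psi) {eps : ℝ} (heps : 0 < eps) : 0 < D.rho eps :=
  div_pos heps (mul_pos (by norm_num) hS.Omega_pos)

omit [FiniteDimensional ℝ E] in
-- Dropping ρω_Y changes p_ρ and d_ρ by at most ρΩ each.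
theorem gap_le (hS : D.Standing Psi) {rho : ℝ} (hrho : 0 ≤ rho) {x : E} (hx : x ∈ D.X) {y : F}
    (hy : y ∈ D.Y) : D.gap Psi 0 x y
      ≤ D.primalFn Psi rho x - D.dualFn Psi rho y + 2 * (rho * D.Omega) := by
  have h1 := (hS.ybest_spec rho hx).2 _ (hS.ybest_spec 0 hx).1
  have h2 := hS.fbar_eq rho hx
  have h3 := hS.fbar_eq 0 hx
  have h4 := mul_le_mul_of_nonneg_left (abs_le.1 (hS.abs_omegaY_le (hS.ybest_spec 0 hx).1)).2 hrho
  have h5 := mul_le_mul_of_nonneg_left (abs_le.1 (hS.abs_omegaY_le hy)).1 hrho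
  rw [gap, primalFn, primalFn, h2, h3]
  unfold dualFn psiD at *
  linarith

omit [FiniteDimensional ℝ E] [FiniteDimensional ℝ F] in
theorem Lrho_pos (hS : D.Standing Psi) {rho : ℝ} (hrho : 0 ≤ rho) : 0 < D.Lrho rho :=
  add_pos_of_pos_of_nonneg hS.Lxx_pos (div_nonneg (sq_nonneg _) hrho)

omit [FiniteDimensional ℝ E] [FiniteDimensional ℝ F] in
theorem accFactor_nonneg (hS : D.Standing Psi) (xh : E) {rho eps : ℝ} (hrho : 0 ≤ rho)
    (heps : 0 ≤ eps) : 0 ≤ D.accFactor Psi xh rho eps := by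
  have h1 := hS.Lrho_pos hrho
  have h2 := hS.betaX_ge
  exact le_min (by positivity) (by positivity)

/-- Pairs with the prescribed accuracies solve the saddle-point problem. -/
theorem approximate_solution (hS : D.Standing Psi) (xh : E) {eps : ℝ} (heps : 0 < eps) {x : E}
    (hx : x ∈ D.X) {y : F} (hy : y ∈ D.Y)
    (hd : D.dualOpt Psi (D.rho eps) - D.dualFn Psi (D.rho eps) y ≤ D.eps3 Psi xh (D.rho eps) eps)
    (hp : D.psiP Psi x y - D.piFn Psi y ≤ D.eps4 Psi xh (D.rho eps) eps) :
    D.primalFn Psi (D.rho eps) x - D.primalOpt Psi (D.rho eps) ≤ eps / 4 ∧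
      D.gap Psi 0 x y ≤ eps := by
  have hrho := hS.rho_pos heps
  have hrO : D.rho eps * D.Omega = eps / 4 := by
    have := hS.Omega_pos
    unfold SaddleData.rho; field_simp
  have hmu := hS.mu_pos
  have hxy := hS.Lxy_pos
  set rho := D.rho eps
  have hk0 := hS.accFactor_nonneg xh hrho.le heps.le
  have hk1 : D.accFactor Psi xh rho eps * (D.Lrho rho + D.betaX) ≤ 1 := by
    rw [← le_div_iff₀ (by linarith [hS.Lrho_pos hrho.le, hS.betaX_ge])]
    exact min_le_right _ _
  have he3 : D.eps3 Psi xh rho eps ≤ eps / 4 := min_le_right _ _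
  have he3' : D.eps3 Psi xh rho eps
      ≤ eps * D.mu ^ 2 * rho / (64 * D.Lxy ^ 2) * D.accFactor Psi xh rho eps := min_le_left _ _
  have he4 : D.eps4 Psi xh rho eps = eps * D.mu / 64 * D.accFactor Psi xh rho eps := rfl
  have hys := (hS.ystar_spec rho).1
  have g1 := hS.dualFn_growth hrho.le hy
  have g2 := hS.psiP_growth hx hy
  have g3 := hS.xstar_lipschitz hy hys
  have g4 := hS.primalFn_sub_dualOpt_le hrho hx hy
  have g5 := hS.dualOpt_le_primalOpt rho
  have g6 := hS.gap_le hrho.le hx hy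
  set ka := D.accFactor Psi xh rho eps
  set ys := D.ystar Psi rho
  set xs := D.xstar Psi ys
  -- The common length that ε₃ and ε₄ were designed for: both ‖x - x*(y)‖ and (L_xy/μ)‖y - ys‖ turn
  -- out to be at most s.
  set s := √(eps * ka / 32) with hs
  have hs0 : 0 ≤ s := Real.sqrt_nonneg _
  have hs2 : s ^ 2 = eps * ka / 32 := Real.sq_sqrt (by positivity)
  have b1 : D.Lxy * ‖y - ys‖ ≤ D.mu * s := by
    refine abs_le_of_sq_le_sq' ?_ (by positivity) |>.2
    rw [mul_pow, mul_pow, hs2]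
    have h1 : rho / 2 * ‖y - ys‖ ^ 2 ≤ eps * D.mu ^ 2 * rho / (64 * D.Lxy ^ 2) * ka := by linarith
    have h2 : eps * D.mu ^ 2 * rho / (64 * D.Lxy ^ 2) * ka
        = rho / 2 * (D.mu ^ 2 * (eps * ka / 32) / D.Lxy ^ 2) := by field_simp; ring
    rw [h2] at h1
    have h3 := le_of_mul_le_mul_left h1 (by positivity)
    rw [le_div_iff₀ (by positivity)] at h3
    linarith
  have b2 : ‖x - D.xstar Psi y‖ ≤ s := by
    refine abs_le_of_sq_le_sq' ?_ hs0 |>.2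
    rw [hs2]
    have h1 : D.mu / 2 * ‖x - D.xstar Psi y‖ ^ 2 ≤ D.mu / 2 * (eps * ka / 32) := by
      linarith
    exact le_of_mul_le_mul_left h1 (by positivity)
  have b3 : ‖D.xstar Psi y - xs‖ ≤ s := by
    refine g3.trans ?_
    rw [div_mul_eq_mul_div, div_le_iff₀ hmu]
    linarith
  have b4 : ‖x - xs‖ ≤ 2 * s := by
    have : x - xs = (x - D.xstar Psi y) + (D.xstar Psi y - xs) := by abel
    rw [this]
    exact (norm_add_le _ _).trans (by linarith)
  have b5 : D.Lxy * (D.Lxy / rho * ‖x - xs‖ + ‖y - ys‖) * ‖x - xs‖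
      ≤ (4 * (D.Lxy ^ 2 / rho) + 2 * D.mu) * s ^ 2 := by
    have h1 : D.Lxy * (D.Lxy / rho * ‖x - xs‖ + ‖y - ys‖)
        ≤ D.Lxy ^ 2 / rho * (2 * s) + D.mu * s := by
      have : D.Lxy ^ 2 / rho * ‖x - xs‖ ≤ D.Lxy ^ 2 / rho * (2 * s) := by gcongr
      have e : D.Lxy * (D.Lxy / rho * ‖x - xs‖ + ‖y - ys‖)
        = D.Lxy ^ 2 / rho * ‖x - xs‖ + D.Lxy * ‖y - ys‖ := by ring
      rw [e]; linarith
    calc _ ≤ (D.Lxy ^ 2 / rho * (2 * s) + D.mu * s) * (2 * s) :=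
          mul_le_mul h1 b4 (norm_nonneg _) (by positivity)
      _ = _ := by ring
  have b6 : (4 * (D.Lxy ^ 2 / rho) + 2 * D.mu) * s ^ 2 ≤ eps / 8 := by
    -- Only the entry 1/(L'_ρ + β_X) of the minimum κ enters here; μ ≤ L'_xx absorbs the term 2μ.
    have h1 : 4 * (D.Lxy ^ 2 / rho) + 2 * D.mu ≤ 4 * (D.Lrho rho + D.betaX) := by
      unfold Lrho; linarith [hS.mu_le, hS.betaX_ge, hS.Lxx_pos]
    calc _ ≤ 4 * (D.Lrho rho + D.betaX) * s ^ 2 := by gcongr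
      _ = eps / 8 * (ka * (D.Lrho rho + D.betaX)) := by rw [hs2]; ring
      _ ≤ eps / 8 * 1 := by gcongr
      _ = eps / 8 := mul_one _
  have b7 : D.eps4 Psi xh rho eps ≤ eps / 64 := by
    have h1 : D.mu ≤ D.Lrho rho + D.betaX := by
      have : 0 ≤ D.Lxy ^ 2 / rho := by positivity
      unfold Lrho; linarith [hS.mu_le, hS.betaX_ge]
    have h2 : ka * D.mu ≤ 1 := (mul_le_mul_of_nonneg_left h1 hk0).trans hk1
    rw [he4]
    nlinarith
  constructor
  · linarith
  · linarith

end Dual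

end Standing

end SaddleData

/-! ### Oracle calls and accuracy of the solvers -/

namespace APGInput

variable {V : Type w} [NormedAddCommGroup V] [NormedSpace ℝ V]
  {E : Type u} {F : Type v} [NormedAddCommGroup E] [NormedSpace ℝ E]
  [NormedAddCommGroup F] [NormedSpace ℝ F]
  (OX : E → F → (E →L[ℝ] ℝ)) (OY : E → F → (F →L[ℝ] ℝ))

theorem primalCalls_run (I : APGInput V) {grad : V → OracleProg E F (V →L[ℝ] ℝ)} {c : ℕ}
    (h : ∀ a, (grad a).primalCalls OX OY = c) (u0 : V) (k : ℕ) :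
    (I.run grad u0 k).primalCalls OX OY = k * c := by
  have h1 : ∀ t, (I.iterate grad u0 t).primalCalls OX OY = t * c := by
    intro t
    induction t with
    | zero => simp [iterate, OracleProg.primalCalls]
    | succ t ih =>
      simp only [iterate, OracleProg.primalCalls_bind, OracleProg.primalCalls, ih, h]
      ring
  simp [run, OracleProg.primalCalls_bind, OracleProg.primalCalls, h1]

theorem dualCalls_run (I : APGInput V) {grad : V → OracleProg E F (V →L[ℝ] ℝ)} {c : ℕ}
    (h : ∀ a, (grad a).dualCalls OX OY = c) (u0 : V) (k : ℕ) :
    (I.run grad u0 k).dualCalls OX OY = k * c := by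
  have h1 : ∀ t, (I.iterate grad u0 t).dualCalls OX OY = t * c := by
    intro t
    induction t with
    | zero => simp [iterate, OracleProg.dualCalls]
    | succ t ih =>
      simp only [iterate, OracleProg.dualCalls_bind, OracleProg.dualCalls, ih, h]
      ring
  simp [run, OracleProg.dualCalls_bind, OracleProg.dualCalls, h1]

omit [NormedAddCommGroup V] [NormedSpace ℝ V] in
theorem alpha_pow_le_of_log_le (I : APGInput V) (hmu : 0 < I.mu) (hL : 0 < I.L) {s : ℝ}
    (hs : 0 < s) {k : ℕ} (hk : (1 + I.tau) * Real.log (1 / s) ≤ k) : I.alpha ^ k ≤ s := by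
  have ht := I.tau_pos hmu hL
  refine (I.alpha_pow_le_exp hmu hL k).trans ?_
  rw [← Real.le_log_iff_exp_le hs]
  rw [one_div, Real.log_inv] at hk
  have : -Real.log s ≤ k / (1 + I.tau) := by
    rw [le_div_iff₀ (by linarith)]; linarith
  linarith

end APGInput

namespace SaddleData

variable {E : Type u} {F : Type v} [NormedAddCommGroup E] [NormedSpace ℝ E]
  [NormedAddCommGroup F] [NormedSpace ℝ F]
  {D : SaddleData E F} {Psi : E → F → ℝ}
  (OX : E → F → (E →L[ℝ] ℝ)) (OY : E → F → (F →L[ℝ] ℝ))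

theorem primalCalls_primalSolver (D : SaddleData E F) (x0 : E) (n : ℕ) (y : F) :
    (D.primalSolver x0 n y).primalCalls OX OY = n := by
  rw [primalSolver, APGInput.primalCalls_run OX OY _ (c := 1) (fun _ => rfl), mul_one]

theorem dualCalls_primalSolver (D : SaddleData E F) (x0 : E) (n : ℕ) (y : F) :
    (D.primalSolver x0 n y).dualCalls OX OY = 0 := by
  rw [primalSolver, APGInput.dualCalls_run OX OY _ (c := 0) (fun _ => rfl), mul_zero]

theorem primalCalls_method (D : SaddleData E F) (rho : ℝ) (x0 : E) (y0 : F) (k n m : ℕ) :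
    (D.method rho x0 y0 k n m).primalCalls OX OY = k * n + m := by
  rw [method, OracleProg.primalCalls_bind, OracleProg.primalCalls_bind, primalCalls_primalSolver,
    dualSolver, APGInput.primalCalls_run OX OY _ (c := n)]
  · rfl
  · intro y
    rw [OracleProg.primalCalls_bind, primalCalls_primalSolver]
    rfl

theorem dualCalls_method (D : SaddleData E F) (rho : ℝ) (x0 : E) (y0 : F) (k n m : ℕ) :
    (D.method rho x0 y0 k n m).dualCalls OX OY = k := by
  rw [method, OracleProg.dualCalls_bind, OracleProg.dualCalls_bind, dualCalls_primalSolver,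
    dualSolver, APGInput.dualCalls_run OX OY _ (c := 1)]
  · simp [OracleProg.dualCalls]
  · intro y
    rw [OracleProg.dualCalls_bind, dualCalls_primalSolver]
    rfl

theorem method_result (D : SaddleData E F) (rho : ℝ) (x0 : E) (y0 : F) (k n m : ℕ) :
    (D.method rho x0 y0 k n m).result OX OY =
      ((D.primalSolver x0 m ((D.dualSolver rho x0 y0 k n).result OX OY)).result OX OY,
        (D.dualSolver rho x0 y0 k n).result OX OY) := by
  rw [method, OracleProg.result_bind, OracleProg.result_bind]
  rfl

/-! ### Convergence of the primal and the dual solver. -/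

namespace Standing

/-- The two Bregman divergences between a and b add up to the pairing of the gradient difference
with a - b, and the other one is nonnegative. -/
theorem bregman_omegaX_le (hS : D.Standing Psi) {a b : E} (ha : a ∈ D.X) (hb : b ∈ D.X) :
    bregman D.omegaX a b ≤ D.betaX * ‖a - b‖ ^ 2 := by
  have h1 := hS.omegaX_dgf.bregman_nonneg hb (hS.mem_interior ha)
  have h2 : bregman D.omegaX a b + bregman D.omegaX b a
      = (fderiv ℝ D.omegaX a - fderiv ℝ D.omegaX b) (a - b) := by
    simp only [bregman, sub_apply, map_sub]; ring
  have h3 := (fderiv ℝ D.omegaX a - fderiv ℝ D.omegaX b).le_of_opNorm_le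
    (hS.omegaX_smooth a ha b hb) (a - b)
  have h4 := Real.le_norm_self ((fderiv ℝ D.omegaX a - fderiv ℝ D.omegaX b) (a - b))
  nlinarith

theorem norm_sub_le_diam (hS : D.Standing Psi) {y y' : F} (hy : y ∈ D.Y) (hy' : y' ∈ D.Y) :
    ‖y - y'‖ ≤ Metric.diam D.Y := by
  rw [← dist_eq_norm]; exact Metric.dist_le_diam_of_mem hS.Y_bounded hy hy'

variable [FiniteDimensional ℝ E]

/-- Although X may be unbounded, x* is Lipschitz on the bounded set Y. This makes the inner
iteration number uniform in y. -/
theorem exists_norm_sub_xstar_sq_le (hS : D.Standing Psi) (x0 : E) :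
    ∃ R : ℝ, 0 ≤ R ∧ ∀ y ∈ D.Y, ‖x0 - D.xstar Psi y‖ ^ 2 ≤ R := by
  obtain ⟨y1, hy1⟩ := hS.Y_nonempty
  refine ⟨(‖x0 - D.xstar Psi y1‖ + D.Lxy / D.mu * Metric.diam D.Y) ^ 2, sq_nonneg _,
    fun y hy => pow_le_pow_left₀ (norm_nonneg _) ?_ 2⟩
  have h1 := hS.xstar_lipschitz hy1 hy
  have h2 := mul_le_mul_of_nonneg_left (hS.norm_sub_le_diam hy1 hy)
    (div_pos hS.Lxy_pos hS.mu_pos).le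
  have h3 : x0 - D.xstar Psi y
      = (x0 - D.xstar Psi y1) + (D.xstar Psi y1 - D.xstar Psi y) := by abel
  rw [h3]
  exact (norm_add_le _ _).trans (by linarith)

/-- Linear convergence of the primal solver, uniformly in `y`. -/
theorem primalSolver_accuracy (hS : D.Standing Psi) (hOX : D.IsPrimalOracle Psi OX) {x0 : E}
    (hx0 : x0 ∈ D.X) : ∃ K : ℝ, 1 ≤ K ∧ ∀ delta : ℝ, 0 < delta → delta ≤ 1 → ∀ n : ℕ, n ≠ 0 →
      (1 + √(D.Lxx / D.mu)) * Real.log (K / delta) ≤ n → ∀ y ∈ D.Y,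
        (D.primalSolver x0 n y).result OX OY ∈ D.X ∧
        D.psiP Psi ((D.primalSolver x0 n y).result OX OY) y - D.piFn Psi y ≤ delta := by
  obtain ⟨R, hR0, hR⟩ := hS.exists_norm_sub_xstar_sq_le x0
  have hmu := hS.mu_pos
  have hL := hS.Lxx_pos
  have hbeta : 0 < D.betaX := zero_lt_one.trans_le hS.betaX_ge
  -- The convergence bound contains ‖x0 - x‖² for the output x itself. Quadratic growth bounds it by
  -- R and a multiple of the error P; the first two terms of K make α^n small enough to absorb that
  -- multiple on the left.
  set K := 2 + 4 * (D.Lxx / D.mu) + 2 * (D.mu * D.betaX + D.Lxx) * R with hK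
  have hK1 : 2 + 4 * (D.Lxx / D.mu) ≤ K := le_add_of_nonneg_right (by positivity)
  have hK2 : 2 * (D.mu * D.betaX + D.Lxx) * R ≤ K := le_add_of_nonneg_left (by positivity)
  have hLmu : 0 < D.Lxx / D.mu := div_pos hL hmu
  refine ⟨K, by linarith, fun delta hd0 hd1 n hn hlog y hy => ?_⟩
  have hKpos : 0 < K := by linarith
  let I : APGInput E := ⟨D.X, D.r, D.omegaX, D.mu, D.Lxx⟩
  have hpow : I.alpha ^ n ≤ delta / K := by
    refine I.alpha_pow_le_of_log_le hmu hL (div_pos hd0 hKpos) ?_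
    rw [one_div_div]
    exact hlog
  obtain ⟨hmem, hrun⟩ := I.run_spec OX OY (h := fun x => Psi x y)
    (G := fun x => gradX Psi x y) (sigma := 0) hmu hL hS.X_convex hS.omegaX_dgf
    hS.r_convex hS.r_bpp (hS.isSmoothConvexOn_Psi hy) (fun x => .primal x y fun xi => .ret xi)
    (fun a ha b _ c _ => by
      change (OX a y - gradX Psi a y) (b - c) ≤ 0
      rw [hOX a ha y hy, sub_self]; rfl)
    (hS.mem_interior hx0) hn
  change (D.primalSolver x0 n y).result OX OY ∈ D.X at hmem
  refine ⟨hmem, ?_⟩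
  have h1 := hrun _ (hS.xstar_mem hy)
  change (1 - I.alpha ^ n) * (D.psiP Psi ((D.primalSolver x0 n y).result OX OY) y
      - D.psiP Psi (D.xstar Psi y) y) ≤ I.alpha ^ n * (D.mu * bregman D.omegaX (D.xstar Psi y) x0
      + D.Lxx / 2 * ‖x0 - (D.primalSolver x0 n y).result OX OY‖ ^ 2)
      + (1 - I.alpha ^ n) * 0 at h1
  rw [← hS.piFn_eq hy] at h1
  have h2 := hS.psiP_growth hmem hy
  set x := (D.primalSolver x0 n y).result OX OY
  set q := D.xstar Psi y
  set P := D.psiP Psi x y - D.piFn Psi y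
  set a := I.alpha ^ n
  have ha0 : 0 ≤ a := pow_nonneg (I.alpha_pos hmu hL).le n
  have h3 := hS.bregman_omegaX_le (hS.xstar_mem hy) hx0
  have h4 : ‖x0 - x‖ ^ 2 ≤ 2 * ‖x0 - q‖ ^ 2 + 2 * ‖x - q‖ ^ 2 := by
    have : x0 - x = (x0 - q) - (x - q) := by abel
    have h5 : ‖x0 - x‖ ≤ ‖x0 - q‖ + ‖x - q‖ := by rw [this]; exact norm_sub_le _ _
    nlinarith [norm_nonneg (x0 - x), sq_nonneg (‖x0 - q‖ - ‖x - q‖)]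
  rw [norm_sub_rev] at h3
  have h6 := hR y hy
  have hP0 : 0 ≤ P := le_trans (by positivity) h2
  have h7 : ‖x - q‖ ^ 2 ≤ 2 * P / D.mu := by
    rw [le_div_iff₀ hmu]; linarith
  have h8 : D.mu * bregman D.omegaX q x0 + D.Lxx / 2 * ‖x0 - x‖ ^ 2
      ≤ (D.mu * D.betaX + D.Lxx) * R + 2 * (D.Lxx / D.mu) * P := by
    have i1 : D.mu * bregman D.omegaX q x0 ≤ D.mu * (D.betaX * R) :=
      mul_le_mul_of_nonneg_left (h3.trans (mul_le_mul_of_nonneg_left h6 hbeta.le)) hmu.le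
    have i2 : D.Lxx / 2 * ‖x0 - x‖ ^ 2 ≤ D.Lxx / 2 * (2 * R + 2 * (2 * P / D.mu)) :=
      mul_le_mul_of_nonneg_left (by linarith) (by positivity)
    have i3 : D.Lxx / 2 * (2 * R + 2 * (2 * P / D.mu))
        = D.Lxx * R + 2 * (D.Lxx / D.mu) * P := by field_simp
    linarith
  have h9 := mul_le_mul_of_nonneg_left h8 ha0
  have h10 : a * K ≤ delta := (le_div_iff₀ hKpos).1 hpow
  have h11 : a * (2 + 4 * (D.Lxx / D.mu)) ≤ 1 :=
    (mul_le_mul_of_nonneg_left hK1 ha0).trans (h10.trans hd1)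
  have h12 := mul_le_mul_of_nonneg_right h11 hP0
  have h13 := mul_le_mul_of_nonneg_left hK2 ha0
  linarith

variable [FiniteDimensional ℝ F]

/-- Convergence of the dual solver. -/
theorem dualSolver_accuracy (hS : D.Standing Psi) (hOY : D.IsDualOracle Psi OY) (x0 : E)
    {y0 : F} (hy0 : y0 ∈ D.Y ∩ interior D.domY) : ∃ K : ℝ, 1 ≤ K ∧ ∀ rho : ℝ, 0 < rho →
      ∀ s : ℝ, 0 < s → s ≤ 1 / 2 → ∀ n : ℕ,
      (∀ y ∈ D.Y, (D.primalSolver x0 n y).result OX OY ∈ D.X ∧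
        D.psiP Psi ((D.primalSolver x0 n y).result OX OY) y - D.piFn Psi y ≤ s ^ 2) →
      ∀ k : ℕ, k ≠ 0 → (1 + √(D.Lpi / rho)) * Real.log (1 / s) ≤ k →
        (D.dualSolver rho x0 y0 k n).result OX OY ∈ D.Y ∧
        D.dualOpt Psi rho - D.dualFn Psi rho ((D.dualSolver rho x0 y0 k n).result OX OY)
          ≤ K * (1 + rho) * s := by
  have hmu := hS.mu_pos
  have hL := hS.Lpi_pos
  have hO := hS.Omega_pos
  have hxy := hS.Lxy_pos
  have hd0 : 0 ≤ Metric.diam D.Y := Metric.diam_nonneg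
  set dm := Metric.diam D.Y
  -- A bound for the initial Bregman divergence. It uses the gradient of ω_Y only at the interior
  -- point y0, since this gradient may be unbounded on Y.
  set c := 2 * D.Omega + ‖fderiv ℝ D.omegaY y0‖ * dm with hc
  have hc0 : 0 ≤ c := by positivity
  set K := 1 + 2 * c + D.Lpi * dm ^ 2 + D.Lxy * √(2 / D.mu) * dm with hK
  have hp1 : 0 ≤ D.Lpi * dm ^ 2 := by positivity
  have hp2 : 0 ≤ D.Lxy * √(2 / D.mu) * dm := by positivity
  refine ⟨K, by linarith, fun rho hrho s hs0 hs1 n hsolve k hk hlog => ?_⟩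
  let I : APGInput F := ⟨D.Y, D.g, D.omegaY, rho, D.Lpi⟩
  have hpow : I.alpha ^ k ≤ s := I.alpha_pow_le_of_log_le hrho hL hs0 hlog
  obtain ⟨hmem, hrun⟩ := I.run_spec OX OY (h := fun y => -D.piFn Psi y)
    (G := fun y => -gradY Psi (D.xstar Psi y) y) (sigma := D.Lxy * √(2 / D.mu) * dm * s)
    hrho hL hS.Y_convex hS.omegaY_dgf hS.g_convex hS.g_bpp hS.isSmoothConvexOn_neg_piFn
    (fun y => (D.primalSolver x0 n y).bind fun x => .dual x y fun xi => .ret (-xi))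
    (fun a ha b hb c hc => by
      obtain ⟨hx, hacc⟩ := hsolve a ha
      rw [OracleProg.result_bind]
      set x := (D.primalSolver x0 n a).result OX OY
      change (-OY x a - -gradY Psi (D.xstar Psi a) a) (b - c) ≤ _
      rw [hOY x hx a ha]
      have g1 := hS.psiP_growth hx ha
      -- Quadratic growth turns the value error s² into a distance of order s, hence a gradient
      -- error of order s.
      have g2 : ‖x - D.xstar Psi a‖ ≤ √(2 / D.mu) * s := by
        refine abs_le_of_sq_le_sq' ?_ (by positivity) |>.2
        rw [mul_pow, Real.sq_sqrt (by positivity), div_mul_eq_mul_div, le_div_iff₀ hmu]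
        linarith
      have g3 := hS.Psi_smoothYX _ hx _ (hS.xstar_mem ha) a ha
      have g4 := hS.norm_sub_le_diam hb hc
      have g5 : ‖-gradY Psi x a - -gradY Psi (D.xstar Psi a) a‖ ≤ D.Lxy * (√(2 / D.mu) * s) := by
        rw [← neg_sub', norm_neg]
        exact g3.trans (mul_le_mul_of_nonneg_left g2 hxy.le)
      have g6 := (-gradY Psi x a - -gradY Psi (D.xstar Psi a) a).le_of_opNorm_le g5 (b - c)
      refine (Real.le_norm_self _).trans (g6.trans ?_)
      calc _ ≤ D.Lxy * (√(2 / D.mu) * s) * dm :=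
            mul_le_mul_of_nonneg_left g4 (by positivity)
        _ = _ := by ring)
    hy0 hk
  change (D.dualSolver rho x0 y0 k n).result OX OY ∈ D.Y at hmem
  refine ⟨hmem, ?_⟩
  have hys := (hS.ystar_spec rho).1
  have h1 := hrun _ hys
  change (1 - I.alpha ^ k) * (-D.piFn Psi ((D.dualSolver rho x0 y0 k n).result OX OY)
      + D.g ((D.dualSolver rho x0 y0 k n).result OX OY)
      + rho * D.omegaY ((D.dualSolver rho x0 y0 k n).result OX OY)
      - (-D.piFn Psi (D.ystar Psi rho) + D.g (D.ystar Psi rho)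
        + rho * D.omegaY (D.ystar Psi rho))) ≤
      I.alpha ^ k * (rho * bregman D.omegaY (D.ystar Psi rho) y0
      + D.Lpi / 2 * ‖y0 - (D.dualSolver rho x0 y0 k n).result OX OY‖ ^ 2)
      + (1 - I.alpha ^ k) * (D.Lxy * √(2 / D.mu) * dm * s) at h1
  set y := (D.dualSolver rho x0 y0 k n).result OX OY
  set a := I.alpha ^ k
  have ha0 : 0 ≤ a := pow_nonneg (I.alpha_pos hrho hL).le k
  have h2 := hS.dualOpt_eq rho
  set P := D.dualOpt Psi rho - D.dualFn Psi rho y with hP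
  have h3 : -D.piFn Psi y + D.g y + rho * D.omegaY y
      - (-D.piFn Psi (D.ystar Psi rho) + D.g (D.ystar Psi rho)
        + rho * D.omegaY (D.ystar Psi rho)) = P := by
    rw [hP, h2]; unfold dualFn; ring
  rw [h3] at h1
  have h4 : bregman D.omegaY (D.ystar Psi rho) y0 ≤ c := by
    have i1 := (abs_le.1 (hS.abs_omegaY_le hys)).2
    have i2 := (abs_le.1 (hS.abs_omegaY_le hy0.1)).1
    have i3 := (fderiv ℝ D.omegaY y0).le_opNorm (D.ystar Psi rho - y0)
    rw [Real.norm_eq_abs] at i3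
    have i4 := (abs_le.1 i3).1
    have i5 := mul_le_mul_of_nonneg_left (hS.norm_sub_le_diam hys hy0.1)
      (norm_nonneg (fderiv ℝ D.omegaY y0))
    unfold bregman
    linarith
  have h5 : ‖y0 - y‖ ^ 2 ≤ dm ^ 2 :=
    pow_le_pow_left₀ (norm_nonneg _) (hS.norm_sub_le_diam hy0.1 hmem) 2
  have h6 : rho * bregman D.omegaY (D.ystar Psi rho) y0 + D.Lpi / 2 * ‖y0 - y‖ ^ 2
      ≤ rho * c + D.Lpi / 2 * dm ^ 2 :=
    add_le_add (mul_le_mul_of_nonneg_left h4 hrho.le)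
      (mul_le_mul_of_nonneg_left h5 (by positivity))
  have h7 : a * (rho * bregman D.omegaY (D.ystar Psi rho) y0 + D.Lpi / 2 * ‖y0 - y‖ ^ 2)
      ≤ s * (rho * c + D.Lpi / 2 * dm ^ 2) :=
    (mul_le_mul_of_nonneg_left h6 ha0).trans (mul_le_mul_of_nonneg_right hpow (by positivity))
  -- Since α^k ≤ s ≤ 1/2, the factor 1 - α^k is at least 1/2; if the bracket is not positive there
  -- is nothing to prove.
  have h8 : 1 / 2 * (P - D.Lxy * √(2 / D.mu) * dm * s)
      ≤ s * (rho * c + D.Lpi / 2 * dm ^ 2) := by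
    by_cases hneg : P - D.Lxy * √(2 / D.mu) * dm * s ≤ 0
    · exact le_trans (by linarith) (by positivity : (0 : ℝ) ≤ _)
    · have := mul_le_mul_of_nonneg_right (show (1 / 2 : ℝ) ≤ 1 - a by linarith)
        (not_le.1 hneg).le
      linarith
  have h9 : K * (1 + rho) * s = 2 * (s * (rho * c + D.Lpi / 2 * dm ^ 2))
      + D.Lxy * √(2 / D.mu) * dm * s
      + s * (1 + rho + 2 * c + rho * (D.Lpi * dm ^ 2 + D.Lxy * √(2 / D.mu) * dm)) := by
    rw [hK]; ring
  have h10 : 0 ≤ s * (1 + rho + 2 * c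
      + rho * (D.Lpi * dm ^ 2 + D.Lxy * √(2 / D.mu) * dm)) := by positivity
  rw [h9]
  linarith

end Standing

end SaddleData

/-! ### Polynomial bounds in the accuracy -/

/-- `f e ≥ c * e ^ N` on `(0, 1]` for some `c > 0`. -/
def LowerPow (f : ℝ → ℝ) (N : ℕ) : Prop :=
  ∃ c : ℝ, 0 < c ∧ ∀ e : ℝ, 0 < e → e ≤ 1 → c * e ^ N ≤ f e

/-- `0 ≤ f e ≤ c / e ^ N` on `(0, 1]` for some `c > 0`. -/
def UpperPow (f : ℝ → ℝ) (N : ℕ) : Prop :=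
  ∃ c : ℝ, 0 < c ∧ ∀ e : ℝ, 0 < e → e ≤ 1 → 0 ≤ f e ∧ f e * e ^ N ≤ c

theorem UpperPow.const {a : ℝ} (ha : 0 ≤ a) (N : ℕ) : UpperPow (fun _ => a) N :=
  ⟨a + 1, by linarith, fun e he he1 => ⟨ha, by
    have : e ^ N ≤ 1 := pow_le_one₀ he.le he1
    nlinarith⟩⟩

theorem UpperPow.add {f g : ℝ → ℝ} {N : ℕ} (hf : UpperPow f N) (hg : UpperPow g N) :
    UpperPow (fun e => f e + g e) N := by
  obtain ⟨c, hc, hf⟩ := hf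
  obtain ⟨d, hd, hg⟩ := hg
  refine ⟨c + d, by linarith, fun e he he1 => ?_⟩
  have h1 := hf e he he1
  have h2 := hg e he he1
  exact ⟨add_nonneg h1.1 h2.1, by linarith [h1.2, h2.2]⟩

theorem UpperPow.mul {f g : ℝ → ℝ} {N M : ℕ} (hf : UpperPow f N) (hg : UpperPow g M) :
    UpperPow (fun e => f e * g e) (N + M) := by
  obtain ⟨c, hc, hf⟩ := hf
  obtain ⟨d, hd, hg⟩ := hg
  refine ⟨c * d, by positivity, fun e he he1 => ?_⟩
  have h1 := hf e he he1
  have h2 := hg e he he1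
  refine ⟨mul_nonneg h1.1 h2.1, ?_⟩
  calc f e * g e * e ^ (N + M) = (f e * e ^ N) * (g e * e ^ M) := by ring
    _ ≤ c * d := mul_le_mul h1.2 h2.2 (mul_nonneg h2.1 (by positivity)) hc.le

/-- Since √f ≤ 1 + f, the exponent can be kept. It is not sharp, but exponents affect only the
numerical constant. -/
theorem UpperPow.sqrt {f : ℝ → ℝ} {N : ℕ} (hf : UpperPow f N) : UpperPow (fun e => √(f e)) N := by
  obtain ⟨c, hc, hf⟩ := (UpperPow.const zero_le_one N).add hf
  refine ⟨c, hc, fun e he he1 => ⟨Real.sqrt_nonneg _, ?_⟩⟩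
  obtain ⟨h1, h2⟩ := hf e he he1
  refine le_trans (mul_le_mul_of_nonneg_right ?_ (by positivity)) h2
  rw [Real.sqrt_le_iff]
  exact ⟨h1, by nlinarith [sq_nonneg (f e), sq_nonneg (1 + f e)]⟩

theorem LowerPow.const {a : ℝ} (ha : 0 < a) : LowerPow (fun _ => a) 0 :=
  ⟨a, ha, fun e _ _ => by simp⟩

theorem LowerPow.id : LowerPow (fun e => e) 1 := ⟨1, one_pos, fun e _ _ => by simp⟩

theorem LowerPow.mul {f g : ℝ → ℝ} {N M : ℕ} (hf : LowerPow f N) (hg : LowerPow g M) :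
    LowerPow (fun e => f e * g e) (N + M) := by
  obtain ⟨c, hc, hf⟩ := hf
  obtain ⟨d, hd, hg⟩ := hg
  refine ⟨c * d, by positivity, fun e he he1 => ?_⟩
  have h1 := hf e he he1
  have h2 := hg e he he1
  calc c * d * e ^ (N + M) = (c * e ^ N) * (d * e ^ M) := by ring
    _ ≤ f e * g e := mul_le_mul h1 h2 (by positivity) (le_trans (by positivity) h1)

theorem LowerPow.min {f g : ℝ → ℝ} {N M : ℕ} (hf : LowerPow f N) (hg : LowerPow g M) :
    LowerPow (fun e => min (f e) (g e)) (max N M) := by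
  obtain ⟨c, hc, hf⟩ := hf
  obtain ⟨d, hd, hg⟩ := hg
  refine ⟨Min.min c d, lt_min hc hd, fun e he he1 => le_min ?_ ?_⟩
  · refine le_trans (mul_le_mul (min_le_left _ _) ?_ (by positivity) hc.le) (hf e he he1)
    exact pow_le_pow_of_le_one he.le he1 (le_max_left _ _)
  · refine le_trans (mul_le_mul (min_le_right _ _) ?_ (by positivity) hd.le) (hg e he he1)
    exact pow_le_pow_of_le_one he.le he1 (le_max_right _ _)

/-- Here √f ≥ min(f, 1), again without halving the exponent. -/
theorem LowerPow.sqrt {f : ℝ → ℝ} {N : ℕ} (hf : LowerPow f N) : LowerPow (fun e => √(f e)) N := by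
  obtain ⟨c, hc, hf⟩ := hf.min (LowerPow.const one_pos)
  rw [max_eq_left (Nat.zero_le N)] at hf
  refine ⟨c, hc, fun e he he1 => (hf e he he1).trans ?_⟩
  have h := hf e he he1
  have h0 : 0 < Min.min (f e) 1 := lt_of_lt_of_le (by positivity) h
  refine Real.le_sqrt_of_sq_le ?_
  calc Min.min (f e) 1 ^ 2 = Min.min (f e) 1 * Min.min (f e) 1 := sq _
    _ ≤ Min.min (f e) 1 * 1 := mul_le_mul_of_nonneg_left (min_le_right _ _) h0.le
    _ ≤ f e := by rw [mul_one]; exact min_le_left _ _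

theorem UpperPow.lowerPow_inv {f : ℝ → ℝ} {N : ℕ} (hf : UpperPow f N)
    (hpos : ∀ e, 0 < e → 0 < f e) :
    LowerPow (fun e => (f e)⁻¹) N := by
  obtain ⟨c, hc, hf⟩ := hf
  refine ⟨c⁻¹, by positivity, fun e he he1 => ?_⟩
  have h := (hf e he he1).2
  have hp := hpos e he
  dsimp only
  rw [← one_div, ← one_div, div_mul_eq_mul_div, one_mul, div_le_div_iff₀ hc hp]
  linarith

theorem LowerPow.congr {f g : ℝ → ℝ} {N : ℕ} (hf : LowerPow f N)
    (h : ∀ e, 0 < e → f e = g e) : LowerPow g N := by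
  obtain ⟨c, hc, hf⟩ := hf
  exact ⟨c, hc, fun e he he1 => (h e he) ▸ hf e he he1⟩

/-- The logarithm of the inverse of a polynomially bounded function grows at most
logarithmically. -/
theorem LowerPow.log_div_le {f : ℝ → ℝ} {N : ℕ} (hf : LowerPow f N) (hpos : ∀ e, 0 < e → 0 < f e)
    {K : ℝ} (hK : 0 < K) : ∃ e0 : ℝ, 0 < e0 ∧ ∀ e : ℝ, 0 < e → e ≤ e0 →
      Real.log (K / f e) ≤ (N + 1) * Real.log (1 / e) := by
  obtain ⟨c, hc, hf⟩ := hf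
  -- For e ≤ c/K one additional power of e swallows the constant K/c; hence the exponent N + 1.
  refine ⟨Min.min 1 (c / K), lt_min one_pos (by positivity), fun e he he0 => ?_⟩
  have h1 := hf e he (he0.trans (min_le_left _ _))
  have h2 : e * K ≤ c := (le_div_iff₀ hK).1 (he0.trans (min_le_right _ _))
  have h3 : K / f e ≤ (1 / e) ^ (N + 1) := by
    rw [one_div_pow, div_le_div_iff₀ (hpos e he) (by positivity), one_mul]
    calc K * e ^ (N + 1) = (e * K) * e ^ N := by ring
      _ ≤ c * e ^ N := mul_le_mul_of_nonneg_right h2 (by positivity)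
      _ ≤ f e := h1
  have h4 := Real.log_le_log (div_pos hK (hpos e he)) h3
  rw [Real.log_pow] at h4
  exact_mod_cast h4

namespace SaddleData

variable {E : Type u} {F : Type v} [NormedAddCommGroup E] [NormedSpace ℝ E]
  [NormedAddCommGroup F] [NormedSpace ℝ F]
  {D : SaddleData E F} {Psi : E → F → ℝ}

/-! ### Dependence of the method's parameters on ε. -/

namespace Standing

theorem lowerPow_rho (hS : D.Standing Psi) : LowerPow (fun e => D.rho e) 1 := by
  have := hS.Omega_pos
  refine ⟨1 / (4 * D.Omega), by positivity, fun e he _ => ?_⟩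
  unfold SaddleData.rho
  rw [pow_one, div_mul_eq_mul_div, one_mul]

theorem upperPow_rho (hS : D.Standing Psi) (N : ℕ) : UpperPow (fun e => D.rho e) N := by
  have := hS.Omega_pos
  refine ⟨1 / (4 * D.Omega), by positivity, fun e he he1 => ⟨(hS.rho_pos he).le, ?_⟩⟩
  have h1 : e ^ N ≤ 1 := pow_le_one₀ he.le he1
  have h2 : D.rho e ≤ 1 / (4 * D.Omega) := by unfold SaddleData.rho; gcongr
  nlinarith [hS.rho_pos he]

theorem upperPow_div_rho (hS : D.Standing Psi) {a : ℝ} (ha : 0 ≤ a) :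
    UpperPow (fun e => a / D.rho e) 1 := by
  have := hS.Omega_pos
  refine ⟨4 * D.Omega * a + 1, by positivity, fun e he he1 =>
    ⟨div_nonneg ha (hS.rho_pos he).le, ?_⟩⟩
  have : a / D.rho e * e ^ 1 = 4 * D.Omega * a := by unfold SaddleData.rho; field_simp
  linarith

theorem upperPow_Lrho (hS : D.Standing Psi) : UpperPow (fun e => D.Lrho (D.rho e)) 1 :=
  (UpperPow.const hS.Lxx_pos.le 1).add (hS.upperPow_div_rho (sq_nonneg _))

theorem boundF_pos (hS : D.Standing Psi) (xh : E) {rho : ℝ} (hrho : 0 ≤ rho) :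
    0 < D.boundF Psi xh rho := by
  have := hS.mu_pos
  have := hS.Lxx_pos
  have := hS.Lxy_pos
  have := hS.Lrho_pos hrho
  have h1 : 0 ≤ sSup ((fun y => ‖gradX Psi xh y‖) '' D.Y) :=
    Real.sSup_nonneg (by rintro _ ⟨y, _, rfl⟩; exact norm_nonneg _)
  have h2 : 0 ≤ Metric.diam D.Y := Metric.diam_nonneg
  unfold boundF
  positivity

theorem boundOmega_nonneg (hS : D.Standing Psi) (xh : E) (rho : ℝ) :
    0 ≤ D.boundOmega xh rho := by
  have := hS.mu_pos
  have := hS.Lxy_pos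
  have : 0 < D.betaX := zero_lt_one.trans_le hS.betaX_ge
  unfold boundOmega
  positivity

theorem bounds_pos (hS : D.Standing Psi) (xh : E) {rho : ℝ} (hrho : 0 ≤ rho) :
    0 < D.boundF Psi xh rho + D.Mr + D.boundOmega xh rho := by
  have h1 := hS.boundF_pos xh hrho
  have h2 := hS.boundOmega_nonneg xh rho
  have h3 := hS.Mr_nonneg
  linarith

theorem accFactor_pos (hS : D.Standing Psi) (xh : E) {eps : ℝ} (heps : 0 < eps) :
    0 < D.accFactor Psi xh (D.rho eps) eps := by
  have hrho := hS.rho_pos heps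
  have h1 := hS.Lrho_pos hrho.le
  have h2 := hS.betaX_ge
  have h3 := hS.bounds_pos xh hrho.le
  exact lt_min (by positivity) (by positivity)

theorem eps3_pos (hS : D.Standing Psi) (xh : E) {eps : ℝ} (heps : 0 < eps) :
    0 < D.eps3 Psi xh (D.rho eps) eps := by
  have := hS.rho_pos heps
  have := hS.accFactor_pos xh heps
  have := hS.mu_pos
  have := hS.Lxy_pos
  exact lt_min (by positivity) (by positivity)

theorem eps4_pos (hS : D.Standing Psi) (xh : E) {eps : ℝ} (heps : 0 < eps) :
    0 < D.eps4 Psi xh (D.rho eps) eps := by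
  have := hS.accFactor_pos xh heps
  have := hS.mu_pos
  unfold eps4
  positivity

theorem delta2_pos (hS : D.Standing Psi) {rho e : ℝ} (hrho : 0 < rho) (he : 0 < e) :
    0 < D.delta2 rho e := by
  have := hS.Lpi_pos
  have := hS.mu_pos
  have := hS.Lxy_pos
  unfold delta2
  positivity

theorem upperPow_bounds (hS : D.Standing Psi) (xh : E) :
    UpperPow (fun e => D.boundF Psi xh (D.rho e) + D.Mr + D.boundOmega xh (D.rho e)) 1 := by
  have hmu := hS.mu_pos
  have hO := hS.Omega_pos
  have h1 : UpperPow (fun e => √(D.rho e * D.Omega / D.mu)) 0 := by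
    have := ((hS.upperPow_rho 0).mul (UpperPow.const (div_pos hO hmu).le 0)).sqrt
    simpa only [mul_div_assoc] using this
  have h2 := ((UpperPow.const (zero_le_two (α := ℝ)) 0).mul hS.upperPow_Lrho).mul h1
  have hL := hS.Lxx_pos
  have hxy := hS.Lxy_pos
  have hbeta : 0 < D.betaX := zero_lt_one.trans_le hS.betaX_ge
  have h3 : 0 ≤ sSup ((fun y => ‖gradX Psi xh y‖) '' D.Y) :=
    Real.sSup_nonneg (by rintro _ ⟨y, _, rfl⟩; exact norm_nonneg _)
  have h4 : 0 ≤ Metric.diam D.Y := Metric.diam_nonneg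
  unfold boundF boundOmega
  refine ((UpperPow.add (UpperPow.const (by positivity) 1) h2).add
    (UpperPow.const hS.Mr_nonneg 1)).add ((UpperPow.const (norm_nonneg _) 1).add
      (UpperPow.mul (N := 0) (M := 1) (UpperPow.const (by positivity) 0)
        ((UpperPow.const (by positivity) 1).add (UpperPow.mul (N := 0) (M := 1)
          (UpperPow.const (by positivity) 0)
          ((UpperPow.const zero_le_one 1).add (hS.upperPow_rho 1).sqrt)))))

/-- The bounds B and B' grow at most like 1/ε, through L'_ρ; squaring them and dividing ε by the
result gives the exponent 3. -/
theorem lowerPow_accFactor (hS : D.Standing Psi) (xh : E) :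
    LowerPow (fun e => D.accFactor Psi xh (D.rho e) e) 3 := by
  have hb := hS.upperPow_bounds (xh := xh)
  have h1 : LowerPow (fun e => e / (8 * (D.boundF Psi xh (D.rho e) + D.Mr
      + D.boundOmega xh (D.rho e)) ^ 2)) 3 := by
    have h2 := ((UpperPow.const (a := 8) (by norm_num) 0).mul (hb.mul hb)).lowerPow_inv
      (fun e he => by
        have := hS.bounds_pos xh (hS.rho_pos he).le
        positivity)
    refine (LowerPow.id.mul h2).congr fun e he => ?_
    rw [← sq, ← div_eq_mul_inv]
  have h3 : LowerPow (fun e => 1 / (D.Lrho (D.rho e) + D.betaX)) 1 := by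
    have hbeta : 0 < D.betaX := zero_lt_one.trans_le hS.betaX_ge
    refine ((hS.upperPow_Lrho.add (UpperPow.const hbeta.le 1)).lowerPow_inv
      (fun e he => ?_)).congr fun e he => (one_div _).symm
    linarith [hS.Lrho_pos (hS.rho_pos he).le]
  exact h1.min h3

theorem lowerPow_eps3 (hS : D.Standing Psi) (xh : E) :
    LowerPow (fun e => D.eps3 Psi xh (D.rho e) e) 5 := by
  have hmu := hS.mu_pos
  have hxy := hS.Lxy_pos
  have h1 := ((LowerPow.id.mul (hS.lowerPow_rho)).mul (LowerPow.const
    (show 0 < D.mu ^ 2 / (64 * D.Lxy ^ 2) by positivity))).mul (hS.lowerPow_accFactor xh)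
  have h2 := LowerPow.id.mul (LowerPow.const (show (0 : ℝ) < 1 / 4 by norm_num))
  refine (h1.min h2).congr fun e he => ?_
  unfold eps3
  congr 1 <;> ring

theorem lowerPow_eps4 (hS : D.Standing Psi) (xh : E) :
    LowerPow (fun e => D.eps4 Psi xh (D.rho e) e) 4 := by
  have hmu := hS.mu_pos
  have h1 := (LowerPow.id.mul (LowerPow.const
    (show 0 < D.mu / 64 by positivity))).mul (hS.lowerPow_accFactor xh)
  refine h1.congr fun e he => ?_
  unfold eps4
  ring

theorem lowerPow_delta2 (hS : D.Standing Psi) (xh : E) :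
    LowerPow (fun e => D.delta2 (D.rho e) (D.eps3 Psi xh (D.rho e) e)) 9 := by
  have hmu := hS.mu_pos
  have hxy := hS.Lxy_pos
  have hL := hS.Lpi_pos
  have h1 := (UpperPow.const zero_le_one 1).add (hS.upperPow_div_rho hL.le).sqrt
  have h2 := ((UpperPow.const (show 0 ≤ (14 * √2) ^ 2 * D.Lxy ^ 2 * √D.Lpi by positivity) 0).mul
    (h1.mul h1)).lowerPow_inv (fun e he => by
      have := Real.sqrt_pos.2 hL
      positivity)
  have h3 := (((hS.lowerPow_eps3 xh).mul (LowerPow.const hmu)).mul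
    (hS.lowerPow_rho.mul hS.lowerPow_rho.sqrt)).mul h2
  refine h3.congr fun e he => ?_
  have hrho := hS.rho_pos he
  -- Rewritten as a product, so that the calculus of integer exponents applies.
  have h4 : D.rho e ^ (3 / 2 : ℝ) = D.rho e * √(D.rho e) := by
    rw [Real.sqrt_eq_rpow, ← Real.rpow_one_add' hrho.le (by norm_num)]
    norm_num
  unfold delta2
  rw [h4, ← sq, ← div_eq_mul_inv]

/-! ### The main theorem -/

theorem sqrt_Lpi_le (hS : D.Standing Psi) : √D.Lpi ≤ √D.Lyy + D.Lxy / √D.mu := by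
  have hmu := hS.mu_pos
  have hxy := hS.Lxy_pos
  have h1 : √(D.Lxy ^ 2 / D.mu) = D.Lxy / √D.mu := by
    rw [Real.sqrt_div (sq_nonneg _), Real.sqrt_sq hxy.le]
  rw [← h1]
  rw [Real.sqrt_le_iff]
  refine ⟨by positivity, ?_⟩
  rw [add_sq, Real.sq_sqrt hS.Lyy_nonneg, Real.sq_sqrt (by positivity)]
  have : 0 ≤ 2 * √D.Lyy * √(D.Lxy ^ 2 / D.mu) := by positivity
  unfold Lpi
  linarith

theorem sqrt_Lpi_div_rho (hS : D.Standing Psi) {eps : ℝ} (heps : 0 < eps) :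
    √(D.Lpi / D.rho eps) = 2 * √D.Omega * √D.Lpi * (1 / √eps) := by
  have hO := hS.Omega_pos
  have h1 : D.Lpi / D.rho eps = 2 ^ 2 * D.Omega * D.Lpi * (1 / eps) := by
    unfold SaddleData.rho; field_simp; norm_num
  rw [h1, Real.sqrt_mul (by have := hS.Lpi_pos; positivity), Real.sqrt_mul (by positivity),
    Real.sqrt_mul (by positivity), Real.sqrt_sq (by norm_num), Real.sqrt_div zero_le_one,
    Real.sqrt_one]

end Standing

end SaddleData

/-- A ceiling of `(1 + t) * l` is at most a multiple of `t * ell` when `t, ell ≥ 1`. -/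
theorem natCeil_one_add_mul_add_one_le {t l ell N : ℝ} (ht : 1 ≤ t) (hell : 1 ≤ ell)
    (hN : 0 ≤ N) (hl : l ≤ N * ell) :
    ((⌈(1 + t) * l⌉₊ + 1 : ℕ) : ℝ) ≤ 2 * (N + 1) * (t * ell) := by
  have h1 : (1 + t) * l ≤ 2 * N * (t * ell) := by
    have h2 : (1 + t) * l ≤ (1 + t) * (N * ell) := mul_le_mul_of_nonneg_left hl (by linarith)
    have h3 : (1 + t) * (N * ell) ≤ (2 * t) * (N * ell) :=
      mul_le_mul_of_nonneg_right (by linarith) (by positivity)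
    linarith
  have h4 : (⌈(1 + t) * l⌉₊ : ℝ) ≤ 2 * N * (t * ell) + 1 :=
    (Nat.cast_le.2 (Nat.ceil_le_ceil h1)).trans (Nat.ceil_lt_add_one (by positivity)).le
  have h5 : 1 ≤ t * ell := by nlinarith
  push_cast
  linarith

/-! ### Choice of the accuracies and the final count. -/

namespace SaddleData.Standing

variable {E : Type u} {F : Type v} [NormedAddCommGroup E] [NormedSpace ℝ E]
  [NormedAddCommGroup F] [NormedSpace ℝ F] [FiniteDimensional ℝ E] [FiniteDimensional ℝ F]
  {D : SaddleData E F} {Psi : E → F → ℝ}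
  {OX : E → F → (E →L[ℝ] ℝ)} {OY : E → F → (F →L[ℝ] ℝ)}

/-- Logarithmic factors suffice for all accuracies that the method needs: with `s` the accuracy of
the dual solver and `delta` that of the primal solver. -/
theorem exists_accuracies (hS : D.Standing Psi) (hOX : D.IsPrimalOracle Psi OX)
    (hOY : D.IsDualOracle Psi OY) {x0 : E} (hx0 : x0 ∈ D.X) {y0 : F}
    (hy0 : y0 ∈ D.Y ∩ interior D.domY) (xh : E) :
    ∃ (a b : ℝ → ℝ) (e0 : ℝ), 0 < e0 ∧
      (∀ eps, 0 < eps → eps ≤ e0 →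
        a eps ≤ 6 * Real.log (1 / eps) ∧ b eps ≤ 11 * Real.log (1 / eps)) ∧
      ∀ eps, 0 < eps → ∀ k n m : ℕ, k ≠ 0 → n ≠ 0 → m ≠ 0 →
        (1 + √(D.Lpi / D.rho eps)) * a eps ≤ k → (1 + √(D.Lxx / D.mu)) * b eps ≤ n →
        (1 + √(D.Lxx / D.mu)) * b eps ≤ m →
        (∀ y ∈ D.Y, (D.primalSolver x0 n y).result OX OY ∈ D.X ∧
          D.psiP Psi ((D.primalSolver x0 n y).result OX OY) y - D.piFn Psi y
            ≤ D.delta2 (D.rho eps) (D.eps3 Psi xh (D.rho eps) eps)) ∧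
        ∃ x ∈ D.X, ∃ y ∈ D.Y, (D.method (D.rho eps) x0 y0 k n m).result OX OY = (x, y) ∧
          D.dualOpt Psi (D.rho eps) - D.dualFn Psi (D.rho eps) y
            ≤ D.eps3 Psi xh (D.rho eps) eps ∧
          D.psiP Psi x y - D.piFn Psi y ≤ D.eps4 Psi xh (D.rho eps) eps := by
  obtain ⟨K, hK, hprimal⟩ := hS.primalSolver_accuracy OX OY hOX hx0
  obtain ⟨K', hK', hdual⟩ := hS.dualSolver_accuracy OX OY hOY x0 hy0
  have hKpos : 0 < K := zero_lt_one.trans_le hK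
  have hKpos' : 0 < K' := zero_lt_one.trans_le hK'
  -- The target s is small enough that the dual error K'(1 + ρ)s is at most ε₃. The inner target
  -- `delta` then meets δ₂, ε₄ and s² at once, so one logarithm serves both n and m.
  set s : ℝ → ℝ := fun e =>
    min (D.eps3 Psi xh (D.rho e) e * (K' * (1 + D.rho e))⁻¹) (1 / 2) with hs
  set delta : ℝ → ℝ := fun e =>
    min (min (D.delta2 (D.rho e) (D.eps3 Psi xh (D.rho e) e)) (D.eps4 Psi xh (D.rho e) e))
      (min (s e * s e) 1) with hdelta
  have hfac : ∀ e, 0 < e → 0 < K' * (1 + D.rho e) := fun e he =>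
    mul_pos hKpos' (by linarith [hS.rho_pos he])
  have hs0 : ∀ e, 0 < e → 0 < s e := fun e he =>
    lt_min (mul_pos (hS.eps3_pos xh he) (inv_pos.2 (hfac e he))) (by norm_num)
  have hd0 : ∀ e, 0 < e → 0 < delta e := fun e he =>
    lt_min (lt_min (hS.delta2_pos (hS.rho_pos he) (hS.eps3_pos xh he)) (hS.eps4_pos xh he))
      (lt_min (mul_pos (hs0 e he) (hs0 e he)) one_pos)
  have hsL : LowerPow s 5 := by
    have h1 := ((UpperPow.const hKpos'.le 0).mul ((UpperPow.const zero_le_one 0).add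
      (hS.upperPow_rho 0))).lowerPow_inv hfac
    exact ((hS.lowerPow_eps3 xh).mul h1).min (LowerPow.const (by norm_num))
  have hdL : LowerPow delta 10 :=
    ((hS.lowerPow_delta2 xh).min (hS.lowerPow_eps4 xh)).min
      ((hsL.mul hsL).min (LowerPow.const one_pos))
  -- The exponents 5 and 10 = 2 · 5 of s and `delta` become the factors 6 and 11.
  obtain ⟨e1, he1, hlog1⟩ := hsL.log_div_le hs0 one_pos
  obtain ⟨e2, he2, hlog2⟩ := hdL.log_div_le hd0 hKpos
  refine ⟨fun e => Real.log (1 / s e), fun e => Real.log (K / delta e), min e1 e2,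
    lt_min he1 he2, fun eps heps hle => ⟨?_, ?_⟩, fun eps heps k n m hk hn hm hkl hnl hml => ?_⟩
  · have := hlog1 eps heps (hle.trans (min_le_left _ _))
    norm_num at this ⊢
    exact this
  · have := hlog2 eps heps (hle.trans (min_le_right _ _))
    norm_num at this ⊢
    exact this
  · have hd1 : delta eps ≤ 1 := (min_le_right _ _).trans (min_le_right _ _)
    have hn' := hprimal _ (hd0 eps heps) hd1 n hn hnl
    have hm' := hprimal _ (hd0 eps heps) hd1 m hm hml
    obtain ⟨hy, hyacc⟩ := hdual _ (hS.rho_pos heps) (s eps) (hs0 eps heps) (min_le_right _ _) n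
      (fun y hy => ⟨(hn' y hy).1, (hn' y hy).2.trans (by
        rw [sq]; exact (min_le_right _ _).trans (min_le_left _ _))⟩) k hk hkl
    refine ⟨fun y hy => ⟨(hn' y hy).1, (hn' y hy).2.trans
      ((min_le_left _ _).trans (min_le_left _ _))⟩, _, (hm' _ hy).1, _, hy,
      method_result OX OY D _ x0 y0 k n m, ?_, (hm' _ hy).2.trans
      ((min_le_left _ _).trans (min_le_right _ _))⟩
    refine hyacc.trans ?_
    have h1 : s eps ≤ D.eps3 Psi xh (D.rho eps) eps * (K' * (1 + D.rho eps))⁻¹ := min_le_left _ _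
    have h2 := mul_le_mul_of_nonneg_left h1 (hfac eps heps).le
    rwa [mul_left_comm, mul_inv_cancel₀ (hfac eps heps).ne', mul_one] at h2

end SaddleData.Standing

theorem mainTheorem4 :
    ∃ C : ℝ, 0 < C ∧
    ∀ (E : Type u) [NormedAddCommGroup E] [NormedSpace ℝ E] [FiniteDimensional ℝ E]
      (F : Type v) [NormedAddCommGroup F] [NormedSpace ℝ F] [FiniteDimensional ℝ F]
      (D : SaddleData E F) (Psi : E → F → ℝ), D.Standing Psi →
    ∀ (OX : E → F → (E →L[ℝ] ℝ)) (OY : E → F → (F →L[ℝ] ℝ)),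
      D.IsPrimalOracle Psi OX → D.IsDualOracle Psi OY →
    ∀ x0 ∈ D.X, ∀ y0 ∈ D.Y ∩ interior D.domY,
    ∀ (xh : E) (yh : F), D.IsReference Psi xh yh →
    -- every pair with the prescribed accuracies solves the saddle-point problem
    (∀ eps : ℝ, 0 < eps → ∀ x ∈ D.X, ∀ y ∈ D.Y,
      D.dualOpt Psi (D.rho eps) - D.dualFn Psi (D.rho eps) y ≤ D.eps3 Psi xh (D.rho eps) eps →
      D.psiP Psi x y - D.piFn Psi y ≤ D.eps4 Psi xh (D.rho eps) eps →
      D.primalFn Psi (D.rho eps) x - D.primalOpt Psi (D.rho eps) ≤ eps / 4 ∧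
        D.gap Psi 0 x y ≤ eps) ∧
    -- the method finds such a pair, within the stated numbers of oracle calls
    ∃ eps0 : ℝ, 0 < eps0 ∧ ∀ eps : ℝ, 0 < eps → ∃ k n m : ℕ,
      (∀ k' ≥ k, ∀ n' ≥ n, ∀ m' ≥ m,
        (∀ y ∈ D.Y,
          (D.primalSolver x0 n' y).result OX OY ∈ D.X ∧
          D.psiP Psi ((D.primalSolver x0 n' y).result OX OY) y - D.piFn Psi y
            ≤ D.delta2 (D.rho eps) (D.eps3 Psi xh (D.rho eps) eps)) ∧
        ∃ x ∈ D.X, ∃ y ∈ D.Y,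
          (D.method (D.rho eps) x0 y0 k' n' m').result OX OY = (x, y) ∧
          D.dualOpt Psi (D.rho eps) - D.dualFn Psi (D.rho eps) y
            ≤ D.eps3 Psi xh (D.rho eps) eps ∧
          D.psiP Psi x y - D.piFn Psi y ≤ D.eps4 Psi xh (D.rho eps) eps ∧
          D.primalFn Psi (D.rho eps) x - D.primalOpt Psi (D.rho eps) ≤ eps / 4 ∧
          D.gap Psi 0 x y ≤ eps) ∧
      (eps ≤ eps0 →
        ((D.method (D.rho eps) x0 y0 k n m).primalCalls OX OY : ℝ)
          ≤ C * √D.Omega * (√(D.Lxx / D.mu) * (√D.Lyy + D.Lxy / √D.mu)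
              * (1 / √eps) * Real.log (1 / eps) ^ 2) ∧
        ((D.method (D.rho eps) x0 y0 k n m).dualCalls OX OY : ℝ)
          ≤ C * √D.Omega * ((√D.Lyy + D.Lxy / √D.mu)
              * (1 / √eps) * Real.log (1 / eps))) := by
  -- 1344 = 2 · 28 · 24: k is at most 28 and n at most 24 times their rates, and kn + n ≤ 2kn.
  refine ⟨1344, by norm_num, ?_⟩
  intro E _ _ _ F _ _ _ D Psi hS OX OY hOX hOY x0 hx0 y0 hy0 xh yh _
  refine ⟨fun eps heps x hx y hy hd hp => hS.approximate_solution xh heps hx hy hd hp, ?_⟩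
  obtain ⟨a, b, e0, he0, hlog, hmethod⟩ := hS.exists_accuracies hOX hOY hx0 hy0 xh
  have hL := hS.Lpi_pos
  have hO := hS.Omega_pos
  -- The bound e⁻¹ gives log(1/ε) ≥ 1, and 4ΩL_π gives L_π/ρ ≥ 1, so that rounding up costs only a
  -- constant factor.
  refine ⟨min e0 (min (Real.exp (-1)) (4 * D.Omega * D.Lpi)),
    lt_min he0 (lt_min (Real.exp_pos _) (by positivity)), fun eps heps => ?_⟩
  -- The added 1 keeps the iteration number nonzero, as the averaged output requires.
  set k := ⌈(1 + √(D.Lpi / D.rho eps)) * a eps⌉₊ + 1 with hk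
  set n := ⌈(1 + √(D.Lxx / D.mu)) * b eps⌉₊ + 1 with hn
  have hkl : (1 + √(D.Lpi / D.rho eps)) * a eps ≤ k :=
    (Nat.le_ceil _).trans (Nat.cast_le.2 (Nat.le_succ _))
  have hnl : (1 + √(D.Lxx / D.mu)) * b eps ≤ n :=
    (Nat.le_ceil _).trans (Nat.cast_le.2 (Nat.le_succ _))
  refine ⟨k, n, n, fun k' hk' n' hn' m' hm' => ?_, fun hle => ?_⟩
  · obtain ⟨h1, x, hx, y, hy, hr, hd, hp⟩ := hmethod eps heps k' n' m' (by omega) (by omega)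
      (by omega) (hkl.trans (Nat.cast_le.2 hk')) (hnl.trans (Nat.cast_le.2 hn'))
      (hnl.trans (Nat.cast_le.2 hm'))
    have h2 := hS.approximate_solution xh heps hx hy hd hp
    exact ⟨h1, x, hx, y, hy, hr, hd, hp, h2⟩
  · obtain ⟨hla, hlb⟩ := hlog eps heps (hle.trans (min_le_left _ _))
    have hle1 := (hle.trans (min_le_right _ _)).trans (min_le_left _ _)
    have hle2 := (hle.trans (min_le_right _ _)).trans (min_le_right _ _)
    have hell : 1 ≤ Real.log (1 / eps) := by
      rw [one_div, Real.log_inv]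
      have := Real.log_le_log heps hle1
      rw [Real.log_exp] at this
      linarith
    have ht : 1 ≤ √(D.Lpi / D.rho eps) := by
      rw [Real.one_le_sqrt, one_le_div (hS.rho_pos heps), SaddleData.rho,
        div_le_iff₀ (by positivity)]
      linarith
    have ht' : 1 ≤ √(D.Lxx / D.mu) := by
      rw [Real.one_le_sqrt, one_le_div hS.mu_pos]
      exact hS.mu_le
    have hkb := natCeil_one_add_mul_add_one_le ht hell (by norm_num) hla
    have hnb := natCeil_one_add_mul_add_one_le ht' hell (by norm_num) hlb
    rw [← hk] at hkb
    rw [← hn] at hnb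
    have hk1 : (1 : ℝ) ≤ k := by exact_mod_cast Nat.le_add_left 1 _
    rw [SaddleData.primalCalls_method, SaddleData.dualCalls_method]
    rw [hS.sqrt_Lpi_div_rho heps] at hkb
    set ell := Real.log (1 / eps)
    set t := √(D.Lxx / D.mu)
    set M := √D.Lyy + D.Lxy / √D.mu with hM
    have hMle := hS.sqrt_Lpi_le
    have hMpos : 0 < M := (Real.sqrt_pos.2 hL).trans_le hMle
    have hkb' : (k : ℝ) ≤ 28 * √D.Omega * (M * (1 / √eps) * ell) := by
      refine hkb.trans ?_
      calc 2 * (6 + 1) * (2 * √D.Omega * √D.Lpi * (1 / √eps) * ell)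
          ≤ 2 * (6 + 1) * (2 * √D.Omega * M * (1 / √eps) * ell) := by gcongr
        _ = _ := by ring
    refine ⟨?_, hkb'.trans ?_⟩
    · push_cast
      have hn0 : (0 : ℝ) ≤ n := Nat.cast_nonneg n
      calc (k : ℝ) * n + n ≤ 2 * k * n := by nlinarith
        _ ≤ 2 * (28 * √D.Omega * (M * (1 / √eps) * ell)) * (2 * (11 + 1) * (t * ell)) := by
          gcongr
        _ = 1344 * √D.Omega * (t * M * (1 / √eps) * ell ^ 2) := by ring
    · gcongr
      norm_num
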